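/- Let $d\ge 0$ be an integer and $s>1$. Write $\mathbf R_+^d$ for the vectors with positive entries, compare such vectors componentwise, and let $D_r(0)=\{z\in\mathbf C^d: |z_j|<r_j \text{ for all } j\}$ and $\overline{D_r(0)}=\{z: |z_j|\le r_j \text{ for all } j\}$. For a bounded measurable function $F_0$ with compact support on $\mathbf C^d$ put $$(\Pi_AF_0)(z)=\pi^{-d}\int_{\mathbf C^d}F_0(w)\,e^{(z,w)-|w|^2}\,d\lambda(w),\qquad (z,w)=\sum_j z_j\overline{w_j},$$ where $\lambda$ is Lebesgue measure. Let $\mathcal E_s(\mathbf C^d)$ be the space of Gevrey functions of order $s$ on $\mathbf C^d\simeq\mathbf R^{2d}$: smooth $\varphi$ such that for every compact $K$ there are $C,h>0$ with $|\partial^\alpha\varphi|\le Ch^{|\alpha|}\alpha!^s$ on $K$ for all $\alpha$. Let $\mathcal E_s'(\mathbf C^d)$ be the space of compactly supported Gevrey distributions of order $s$, i.e. the linear forms $u$ on $\mathcal E_s(\mathbf C^d)$ for which there is a compact $K$ such that for every $h>0$ there is $C$ with $|u(\varphi)|\le C\sup_{x\in K,\alpha}|\partial^\alpha\varphi(x)|/(h^{|\alpha|}\alpha!^s)$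 for all $\varphi$; put $(\Pi_Au)(z)=\pi^{-d}\langle u,e^{(z,\cdot)-|\cdot|^2}\rangle$. Let $\mathcal A_{\flat_1}(\mathbf C^d)$ be the space of all $F(z)=\sum_{\alpha\in\mathbf N^d}c(\alpha)\,z^\alpha/\sqrt{\alpha!}$ such that, for some $r\in\mathbf R_+^d$ and $C$, $|c(\alpha)|\le C r^\alpha(\alpha!)^{-1/2}$ for all $\alpha$. For $t_1\le t_2$ in $\mathbf R_+^d$ let $\mathcal R^\infty_{t_1,t_2}(\mathbf C^d)$ be the set of all non-negative $\chi\in L^\infty(\mathbf C^d)$ supported in $\overline{D_{t_2}(0)}$, of the form $\chi(z)=\chi_0(|z_1|,\dots,|z_d|)$, and with $\chi\ge c$ on $D_{t_1}(0)$ for some constant $c>0$ (all almost everywhere). Let $A(K)$ be the set of functions analytic in a neighbourhood of $K$, and let $L^\infty_{A,c}(\mathbf C^d)$ be the set of all $F\cdot\chi_K$, where $K$ is compact, $F\in A(K)$ and $\chi_K$ is the characteristic function of $K$. Then for every entire function $F$ on $\mathbf C^d$ the following conditions are equivalent: 1. $F\in\mathcal A_{\flat_1}(\mathbf C^d)$;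 2. for some $r\in\mathbf R_+^d$ and some $C$, $|F(z)|\le C e^{r_1|z_1|+\cdots+r_d|z_d|}$ for all $z\in\mathbf C^d$; 3. there is $\rho\in\mathbf R_+^d$ such that for every $r\in\mathbf R_+^d$ with $\rho\le r$ there is $r_0\in\mathbf R_+^d$, with $r_{0,j}<r_j$ for all $j$, such that for every $\chi\in\mathcal R^\infty_{r_0,r}(\mathbf C^d)$ there exists $F_0\in A(\overline{D_r(0)})$ with $F=\Pi_A(F_0\cdot\chi)$; 4. there is $r_0\in\mathbf R_+^d$ such that for every $r\in\mathbf R_+^d$ with $r_{0,j}<r_j$ for all $j$ there exist $\chi\in\mathcal R^\infty_{r_0,r}(\mathbf C^d)$ and $F_0\in A(\overline{D_r(0)})$ with $F=\Pi_A(F_0\cdot\chi)$; 5. there is a compactly supported $F_0\in L^\infty(\mathbf C^d)$ with $F=\Pi_AF_0$; 6. there is $F_0\in\mathcal E_s'(\mathbf C^d)$ with $F=\Pi_AF_0$. Moreover, $\Pi_A(\mathcal E_s'(\mathbf C^d))=\Pi_A(L^\infty_{A,c}(\mathbf C^d))=\mathcal A_{\flat_1}(\mathbf C^d)$. -/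

import Mathlib

open MeasureTheory Set
open scoped ENNReal NNReal ContDiff ComplexConjugate

noncomputable section

namespace BargmannPW

/-! Throughout, `ℂ^d` is `Fin d → ℂ` with Lebesgue measure `volume`, and `r ∈ ℝ_+^d` is a function
`Fin d → ℝ` all of whose values are positive. -/

/-- The open polydisc `D_r(0)`. -/
def polydisc {d : ℕ} (r : Fin d → ℝ) : Set (Fin d → ℂ) := {z | ∀ j, ‖z j‖ < r j}

/-- The closed polydisc, the closure of `D_r(0)` when all radii are positive. -/
def closedPolydisc {d : ℕ} (r : Fin d → ℝ) : Set (Fin d → ℂ) := {z | ∀ j, ‖z j‖ ≤ r j}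

/-- The function `w ↦ exp ((z, w) - |w|²)`, where `(z, w) = ∑ j, z_j * conj w_j`. -/
def bargmannKernel {d : ℕ} (z w : Fin d → ℂ) : ℂ :=
  Complex.exp (∑ j, z j * conj (w j) - ∑ j, ((‖w j‖ ^ 2 : ℝ) : ℂ))

/-- `(Π_A F)(z) = π^{-d} ∫ F(w) exp ((z, w) - |w|²) dλ(w)` for functions `F`. -/
def projA {d : ℕ} (F : (Fin d → ℂ) → ℂ) (z : Fin d → ℂ) : ℂ :=
  ((Real.pi : ℂ) ^ d)⁻¹ * ∫ w, F w * bargmannKernel z w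

/-! ### The space `𝒜_{♭₁}` -/

/-- The normalized monomial `e_α(z) = z^α / √(α!)`. -/
def monomialA {d : ℕ} (α : Fin d → ℕ) (z : Fin d → ℂ) : ℂ :=
  (∏ j, z j ^ α j) / ((√(∏ j, (Nat.factorial (α j) : ℝ)) : ℝ) : ℂ)

/-- `𝒜_{♭₁}(ℂ^d)`: all sums of power series `∑ c(α) e_α` whose coefficients satisfy
`|c(α)| ≲ r^α (α!)^{-1/2}` for some `r ∈ ℝ_+^d`. -/
def spaceAFlatOne (d : ℕ) : Set ((Fin d → ℂ) → ℂ) :=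
  {F | ∃ c : (Fin d → ℕ) → ℂ,
    (∃ r : Fin d → ℝ, (∀ j, 0 < r j) ∧ ∃ C : ℝ, ∀ α,
      ‖c α‖ ≤ C * ((∏ j, r j ^ α j) / √(∏ j, (Nat.factorial (α j) : ℝ)))) ∧
    ∀ z, HasSum (fun α => c α * monomialA α z) (F z)}

/-! ### Radial cutoffs and compactly supported bounded functions -/

/-- `χ ∈ ℛ^∞_{t₁,t₂}(ℂ^d)`. As usual for elements of `L^∞`, pointwise properties are meant almost
everywhere. -/
structure IsRadialCutoff {d : ℕ} (t₁ t₂ : Fin d → ℝ) (χ : (Fin d → ℂ) → ℝ) : Prop where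
  memLp : MemLp χ ⊤ volume
  nonneg : ∀ᵐ z, 0 ≤ χ z
  support : ∀ᵐ z, z ∉ closedPolydisc t₂ → χ z = 0
  radial : ∃ χ₀ : (Fin d → ℝ) → ℝ, ∀ᵐ z, χ z = χ₀ (fun j => ‖z j‖)
  lower : ∃ c : ℝ, 0 < c ∧ ∀ᵐ z, z ∈ polydisc t₁ → c ≤ χ z

/-- `L^∞_c(ℂ^d)`: the (essentially) bounded functions with compact (essential) support. -/
def boundedCompact (d : ℕ) : Set ((Fin d → ℂ) → ℂ) :=
  {F | MemLp F ⊤ volume ∧ ∃ K : Set (Fin d → ℂ), IsCompact K ∧ ∀ᵐ z, z ∉ K → F z = 0}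

/-- `L^∞_{A,c}(ℂ^d)`: all products `F · χ_K`, where `K` is compact, `F` is analytic in a
neighbourhood of `K` and `χ_K` is the characteristic function of `K`. -/
def analyticCompact (d : ℕ) : Set ((Fin d → ℂ) → ℂ) :=
  {G | ∃ K : Set (Fin d → ℂ), IsCompact K ∧ ∃ F : (Fin d → ℂ) → ℂ,
    AnalyticOnNhd ℂ F K ∧ G = K.indicator F}

/-! ### Gevrey functions and compactly supported Gevrey distributions

`ℂ^d` is regarded as the real vector space `ℝ^{2d}`. The size of the collection of all partial
derivatives of order `k` at `x` is measured by `‖iteratedFDeriv ℝ k φ x‖`, which agrees with the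
maximum of the `|∂^α φ(x)|`, `|α| = k`, up to factors `B^k`; also `α! ≤ |α|! ≤ (2d)^{|α|} α!`. -/

/-- `φ` is smooth and, on every compact set, `|∂^α φ| ≤ C h^{|α|} (α!)^s` for some `C` and `h`. -/
def IsGevrey {d : ℕ} (s : ℝ) (φ : (Fin d → ℂ) → ℂ) : Prop :=
  ContDiff ℝ ∞ φ ∧ ∀ K : Set (Fin d → ℂ), IsCompact K → ∃ C h : ℝ, 0 < C ∧ 0 < h ∧
    ∀ k : ℕ, ∀ x ∈ K, ‖iteratedFDeriv ℝ k φ x‖ ≤ C * h ^ k * (Nat.factorial k : ℝ) ^ s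

/-- The space `ℰ_s(ℂ^d)` of Gevrey functions of order `s`. -/
def gevreySpace (d : ℕ) (s : ℝ) : Submodule ℂ ((Fin d → ℂ) → ℂ) where
  carrier := {φ | IsGevrey s φ}
  zero_mem' := by
    refine ⟨contDiff_const, fun K _ => ⟨1, 1, one_pos, one_pos, fun k x _ => ?_⟩⟩
    have : iteratedFDeriv ℝ k (0 : (Fin d → ℂ) → ℂ) = 0 := iteratedFDeriv_fun_zero
    rw [this]
    simp only [Pi.zero_apply, norm_zero]
    positivity
  add_mem' := by
    rintro φ ψ ⟨hφ, h1⟩ ⟨hψ, h2⟩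
    refine ⟨hφ.add hψ, fun K hK => ?_⟩
    obtain ⟨C, h, hC, hh, H⟩ := h1 K hK
    obtain ⟨C', h', hC', hh', H'⟩ := h2 K hK
    refine ⟨C + C', max h h', by positivity, by positivity, fun k x hx => ?_⟩
    have e : iteratedFDeriv ℝ k (φ + ψ) x = iteratedFDeriv ℝ k φ x + iteratedFDeriv ℝ k ψ x :=
      iteratedFDeriv_add_apply (hφ.of_le (by exact_mod_cast le_top)).contDiffAt
        (hψ.of_le (by exact_mod_cast le_top)).contDiffAt
    rw [e]
    calc _ ≤ C * h ^ k * (Nat.factorial k : ℝ) ^ s + C' * h' ^ k * (Nat.factorial k : ℝ) ^ s :=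
          (norm_add_le _ _).trans (add_le_add (H k x hx) (H' k x hx))
      _ ≤ C * (max h h') ^ k * (Nat.factorial k : ℝ) ^ s
            + C' * (max h h') ^ k * (Nat.factorial k : ℝ) ^ s := by
          gcongr
          · exact le_max_left _ _
          · exact le_max_right _ _
      _ = _ := by ring
  smul_mem' := by
    rintro a φ ⟨hφ, h1⟩
    refine ⟨contDiff_const.smul hφ, fun K hK => ?_⟩
    obtain ⟨C, h, hC, hh, H⟩ := h1 K hK
    refine ⟨(‖a‖ + 1) * C, h, by positivity, hh, fun k x hx => ?_⟩
    have e : iteratedFDeriv ℝ k (a • φ) x = a • iteratedFDeriv ℝ k φ x :=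
      iteratedFDeriv_const_smul_apply (hφ.of_le (by exact_mod_cast le_top)).contDiffAt
    rw [e, norm_smul]
    have := H k x hx
    have h0 : 0 ≤ ‖iteratedFDeriv ℝ k φ x‖ := norm_nonneg _
    calc ‖a‖ * ‖iteratedFDeriv ℝ k φ x‖ ≤ (‖a‖ + 1) * ‖iteratedFDeriv ℝ k φ x‖ := by
          gcongr; linarith
      _ ≤ (‖a‖ + 1) * (C * h ^ k * (Nat.factorial k : ℝ) ^ s) := by gcongr
      _ = _ := by ring

/-- `ℰ_s'(ℂ^d)`, the compactly supported Gevrey distributions of order `s`: the linear forms `u` on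
`ℰ_s(ℂ^d)` such that, for some compact `K` and all `h > 0`,
`|u(φ)| ≤ C_h sup_{x ∈ K, α} |∂^α φ(x)| / (h^{|α|} (α!)^s)`. (The estimate is required for every
upper bound `M` of the supremum, so that nothing is claimed when the supremum is infinite.) -/
def gevreyDual (d : ℕ) (s : ℝ) : Set (gevreySpace d s →ₗ[ℂ] ℂ) :=
  {u | ∃ K : Set (Fin d → ℂ), IsCompact K ∧ ∀ h : ℝ, 0 < h → ∃ C : ℝ,
    ∀ φ : gevreySpace d s, ∀ M : ℝ, 0 ≤ M →
      (∀ k : ℕ, ∀ x ∈ K, ‖iteratedFDeriv ℝ k (φ : (Fin d → ℂ) → ℂ) x‖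
        ≤ M * (h ^ k * (Nat.factorial k : ℝ) ^ s)) →
      ‖u φ‖ ≤ C * M}

/-! ### The kernel is a Gevrey function -/

theorem local_bound_of_analyticAt {d : ℕ} {f : (Fin d → ℂ) → ℂ} {x : Fin d → ℂ}
    (hf : AnalyticAt ℝ f x) : ∃ U ∈ nhds x, ∃ C h : ℝ, 0 < C ∧ 0 < h ∧
      ∀ k : ℕ, ∀ y ∈ U, ‖iteratedFDeriv ℝ k f y‖ ≤ C * h ^ k * (Nat.factorial k : ℝ) := by
  obtain ⟨p, R, hp⟩ := hf
  obtain ⟨ρ, hρ0, hρR⟩ := ENNReal.lt_iff_exists_nnreal_btwn.1 hp.r_pos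
  have hρ : 0 < ρ := by exact_mod_cast hρ0
  set a : ℝ≥0 := ρ / 2 with ha
  have ha0 : 0 < a := by positivity
  have haa : a + a = ρ := add_halves ρ
  have hrad : ((a : ℝ≥0∞) + (a : ℝ≥0∞)) < p.radius := by
    rw [← ENNReal.coe_add, haa]
    exact hρR.trans_le hp.r_le
  have hsum := p.changeOriginSeries_summable_aux₁ hrad
  set T : ℝ≥0 := ∑' q : (Σ k l : ℕ, { t : Finset (Fin (k + l)) // t.card = l }),
    ‖p (q.1 + q.2.1)‖₊ * a ^ q.2.1 * a ^ q.1 with hT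
  have haR : (a : ℝ≥0∞) < R := by
    refine lt_of_le_of_lt ?_ hρR
    rw [← haa]
    exact_mod_cast le_self_add
  refine ⟨Metric.ball x a, Metric.ball_mem_nhds _ (by exact_mod_cast ha0), (T : ℝ) + 1,
    (a : ℝ)⁻¹, by positivity, by positivity, fun k y hy => ?_⟩
  obtain ⟨v, rfl⟩ : ∃ v, y = x + v := ⟨y - x, by abel⟩
  have hv : ‖v‖₊ < a := by
    have : ‖v‖ < a := by simpa [Metric.mem_ball, dist_eq_norm] using hy
    exact_mod_cast this
  have hvR : (‖v‖₊ : ℝ≥0∞) < R := lt_trans (by exact_mod_cast hv) haR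
  have hq := hp.changeOrigin hvR
  have hk : ‖p.changeOrigin v k‖₊ * a ^ k ≤ T := by
    have h1 := p.nnnorm_changeOrigin_le k (x := v) (hvR.trans_le hp.r_le)
    have hs1 := (NNReal.summable_sigma.1 hsum).1 k
    have hs2 := p.changeOriginSeries_summable_aux₂ (r := ‖v‖₊) (hvR.trans_le hp.r_le) k
    calc ‖p.changeOrigin v k‖₊ * a ^ k
        ≤ (∑' t : Σ l : ℕ, { t : Finset (Fin (k + l)) // t.card = l },
            ‖p (k + t.1)‖₊ * ‖v‖₊ ^ t.1) * a ^ k := by gcongr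
      _ = ∑' t : Σ l : ℕ, { t : Finset (Fin (k + l)) // t.card = l },
            ‖p (k + t.1)‖₊ * ‖v‖₊ ^ t.1 * a ^ k := by rw [NNReal.tsum_mul_right]
      _ ≤ ∑' t : Σ l : ℕ, { t : Finset (Fin (k + l)) // t.card = l },
            ‖p (k + t.1)‖₊ * a ^ t.1 * a ^ k := by
          refine Summable.tsum_le_tsum (fun t => ?_) (hs2.mul_right _) hs1
          gcongr
      _ ≤ T := by
          rw [hT, hsum.tsum_sigma' (fun k => (NNReal.summable_sigma.1 hsum).1 k)]
          exact (NNReal.summable_sigma.1 hsum).2.le_tsum k (fun _ _ => zero_le)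
  have hk' : ‖p.changeOrigin v k‖ ≤ ((T : ℝ) + 1) * (a : ℝ)⁻¹ ^ k := by
    have h2 : ‖p.changeOrigin v k‖ * (a : ℝ) ^ k ≤ T := by exact_mod_cast hk
    have ha' : (0 : ℝ) < (a : ℝ) ^ k := by positivity
    rw [inv_pow, ← div_eq_mul_inv, le_div_iff₀ ha']
    linarith
  refine ContinuousMultilinearMap.opNorm_le_bound (by positivity) fun m => ?_
  rw [hq.iteratedFDeriv_eq_sum_of_completeSpace]
  calc _ ≤ ∑ σ : Equiv.Perm (Fin k), ‖p.changeOrigin v k (fun i => m (σ i))‖ := norm_sum_le _ _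
    _ ≤ ∑ σ : Equiv.Perm (Fin k), ‖p.changeOrigin v k‖ * ∏ i, ‖m i‖ := by
        refine Finset.sum_le_sum fun σ _ => ?_
        refine ((p.changeOrigin v k).le_opNorm _).trans_eq ?_
        congr 1
        exact Equiv.prod_comp σ (fun i => ‖m i‖)
    _ = (Nat.factorial k : ℝ) * (‖p.changeOrigin v k‖ * ∏ i, ‖m i‖) := by
        simp [Finset.sum_const, Fintype.card_perm]
    _ ≤ (Nat.factorial k : ℝ) * ((((T : ℝ) + 1) * (a : ℝ)⁻¹ ^ k) * ∏ i, ‖m i‖) := by gcongr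
    _ = _ := by ring

theorem isGevrey_of_analytic {d : ℕ} {s : ℝ} (hs : 1 ≤ s) {f : (Fin d → ℂ) → ℂ}
    (hf : AnalyticOnNhd ℝ f univ) : IsGevrey s f := by
  refine ⟨(contDiff_omega_iff_analyticOnNhd.2 hf).of_le le_top, fun K hK => ?_⟩
  refine hK.induction_on (p := fun K => ∃ C h : ℝ, 0 < C ∧ 0 < h ∧
    ∀ k : ℕ, ∀ x ∈ K, ‖iteratedFDeriv ℝ k f x‖ ≤ C * h ^ k * (Nat.factorial k : ℝ) ^ s) ?_ ?_ ?_ ?_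
  · exact ⟨1, 1, one_pos, one_pos, fun k x hx => hx.elim⟩
  · rintro S T hST ⟨C, h, hC, hh, H⟩
    exact ⟨C, h, hC, hh, fun k x hx => H k x (hST hx)⟩
  · rintro S T ⟨C, h, hC, hh, H⟩ ⟨C', h', hC', hh', H'⟩
    refine ⟨max C C', max h h', by positivity, by positivity, fun k x hx => ?_⟩
    rcases hx with hx | hx
    · refine (H k x hx).trans ?_
      gcongr
      · exact le_max_left _ _
      · exact le_max_left _ _
    · refine (H' k x hx).trans ?_
      gcongr
      · exact le_max_right _ _
      · exact le_max_right _ _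
  · intro x _
    obtain ⟨U, hU, C, h, hC, hh, H⟩ := local_bound_of_analyticAt (hf x (mem_univ x))
    refine ⟨U, mem_nhdsWithin_of_mem_nhds hU, C, h, hC, hh, fun k y hy => (H k y hy).trans ?_⟩
    have h1 : (1 : ℝ) ≤ (Nat.factorial k : ℝ) := by exact_mod_cast Nat.succ_le_of_lt k.factorial_pos
    have h2 : (Nat.factorial k : ℝ) ≤ (Nat.factorial k : ℝ) ^ s := Real.self_le_rpow_of_one_le h1 hs
    gcongr

theorem analytic_bargmannKernel {d : ℕ} (z : Fin d → ℂ) :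
    AnalyticOnNhd ℝ (bargmannKernel z) univ := by
  intro w _
  have hpr : ∀ j, AnalyticAt ℝ (fun w : Fin d → ℂ => w j) w := fun j =>
    (ContinuousLinearMap.proj (R := ℝ) (φ := fun _ : Fin d => ℂ) j).analyticAt w
  have hcj : ∀ j, AnalyticAt ℝ (fun w : Fin d → ℂ => conj (w j)) w := fun j =>
    ((Complex.conjCLE : ℂ →L[ℝ] ℂ).comp
      (ContinuousLinearMap.proj (R := ℝ) (φ := fun _ : Fin d => ℂ) j)).analyticAt w
  have hq : AnalyticAt ℝ (fun w : Fin d → ℂ =>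
      ∑ j, z j * conj (w j) - ∑ j, w j * conj (w j)) w := by
    refine AnalyticAt.sub ?_ ?_
    · exact Finset.analyticAt_fun_sum _ fun j _ => analyticAt_const.mul (hcj j)
    · exact Finset.analyticAt_fun_sum _ fun j _ => (hpr j).mul (hcj j)
  have hexp : AnalyticAt ℝ Complex.exp
      (∑ j, z j * conj (w j) - ∑ j, w j * conj (w j)) :=
    (Complex.differentiable_exp.analyticAt _).restrictScalars
  have := hexp.comp_of_eq hq rfl
  convert! this using 1
  funext v
  simp [bargmannKernel, Complex.mul_conj']

theorem bargmannKernel_mem {d : ℕ} {s : ℝ} (hs : 1 < s) (z : Fin d → ℂ) :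
    bargmannKernel z ∈ gevreySpace d s :=
  isGevrey_of_analytic hs.le (analytic_bargmannKernel z)

/-- `(Π_A u)(z) = π^{-d} ⟨u, exp ((z, ·) - |·|²)⟩` for linear forms `u` on `ℰ_s(ℂ^d)`, `s > 1`. -/
def projADual {d : ℕ} {s : ℝ} (hs : 1 < s) (u : gevreySpace d s →ₗ[ℂ] ℂ) (z : Fin d → ℂ) : ℂ :=
  ((Real.pi : ℂ) ^ d)⁻¹ * u ⟨bargmannKernel z, bargmannKernel_mem hs z⟩

end BargmannPW

end

namespace BargmannPW

/-! ### Power series in several variables -/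

/-! Everything is read off from Taylor coefficients. Writing `F = ∑ a_α z^α`, membership in `𝒜_{♭₁}`
means `|a_α| ≤ C r^α / α!` (`mem_spaceAFlatOne_iff`). Comparison with the exponential series gives
exponential growth, and Cauchy's inequalities on polydiscs of radii about `α_j / r_j` give the
converse.

The key to analytic preimages is that a radial cutoff makes `Π_A` diagonal on monomials: by rotation
invariance `Π_A(w^α χ) = π^{-d} (m_α / α!) z^α`, where `m_α` is `moment χ α`
(`integral_monomial_mul_kernel`). The coefficients of a preimage are therefore forced to be `b_α =
π^d a_α α! / m_α`. As `m_α ≥ c q^{2α}` for `q` inside the polydisc where `χ` is bounded below, `b_α`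
is of size `(R / q²)^α`, and its series is analytic on the closed polydisc of radii `r` once `q² > r
R` (`exists_analytic_preimage`).

Bounded functions with compact support act as Gevrey distributions by integration. Conversely, for a
Gevrey distribution `u`, expanding the kernel in powers of `z` gives coefficients `π^{-d} u(conj w ^
α * exp(-|w|²)) / α!`. The continuity estimate for a single `h` bounds `u` on these functions by a
constant times `(R + 1)^{|α|}`, and the exponential remainder tends to zero in the same seminorm
(`projADual_mem_spaceAFlatOne`). This closes the circle. -/

theorem hasSum_prod_pi {𝕜 : Type*} [NormedField 𝕜] [CompleteSpace 𝕜] :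
    ∀ {d : ℕ} (f : Fin d → ℕ → 𝕜) (S : Fin d → 𝕜), (∀ j, Summable fun n => ‖f j n‖) →
      (∀ j, HasSum (f j) (S j)) →
      (Summable fun α : Fin d → ℕ => ‖∏ j, f j (α j)‖) ∧
        HasSum (fun α : Fin d → ℕ => ∏ j, f j (α j)) (∏ j, S j)
  | 0, f, S, _, _ => by
    refine ⟨Summable.of_finite, ?_⟩
    simp
  | d + 1, f, S, hf, hS => by
    obtain ⟨h1, h2⟩ := hasSum_prod_pi (fun j => f j.succ) (fun j => S j.succ)
      (fun j => hf j.succ) (fun j => hS j.succ)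
    have h3 := (hf 0).mul_norm h1
    constructor
    · rw [← (Fin.consEquiv fun _ : Fin (d + 1) => ℕ).summable_iff]
      refine h3.congr fun x => ?_
      simp [Fin.prod_univ_succ, Fin.consEquiv]
    · rw [← (Fin.consEquiv fun _ : Fin (d + 1) => ℕ).hasSum_iff, Fin.prod_univ_succ]
      refine ((hS 0).mul h2 h3.of_norm).congr_fun ?_
      intro x
      simp [Fin.prod_univ_succ, Fin.consEquiv]

theorem summable_prod_pow {d : ℕ} {t : Fin d → ℝ} (h0 : ∀ j, 0 ≤ t j) (h1 : ∀ j, t j < 1) :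
    Summable fun α : Fin d → ℕ => ∏ j, t j ^ α j := by
  have hs : ∀ j, Summable fun n : ℕ => ‖t j ^ n‖ := fun j => by
    simpa [abs_of_nonneg (h0 j)] using summable_geometric_of_lt_one (h0 j) (h1 j)
  exact (hasSum_prod_pi (fun j n => t j ^ n) _ hs fun j => (hs j).of_norm.hasSum).2.summable

theorem hasSum_prod_exp {d : ℕ} (x : Fin d → ℂ) :
    (Summable fun α : Fin d → ℕ => ‖∏ j, x j ^ α j / (Nat.factorial (α j) : ℂ)‖) ∧
      HasSum (fun α : Fin d → ℕ => ∏ j, x j ^ α j / (Nat.factorial (α j) : ℂ))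
        (Complex.exp (∑ j, x j)) := by
  rw [Complex.exp_sum]
  refine hasSum_prod_pi (fun j n => x j ^ n / (Nat.factorial n : ℂ)) _
    (fun j => NormedSpace.norm_expSeries_div_summable (x j)) fun j => ?_
  rw [Complex.exp_eq_exp_ℂ]
  exact NormedSpace.expSeries_div_hasSum_exp (x j)

theorem hasSum_prod_real_exp {d : ℕ} (x : Fin d → ℝ) :
    HasSum (fun α : Fin d → ℕ => ∏ j, x j ^ α j / (Nat.factorial (α j) : ℝ))
        (Real.exp (∑ j, x j)) := by
  rw [Real.exp_sum]
  refine (hasSum_prod_pi (fun j n => x j ^ n / (Nat.factorial n : ℝ)) _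
    (fun j => NormedSpace.norm_expSeries_div_summable (x j)) fun j => ?_).2
  rw [Real.exp_eq_exp_ℝ]
  exact NormedSpace.expSeries_div_hasSum_exp (x j)

/-- Abel's lemma: the terms are dominated by the geometric ones `C ∏ (t_j / ρ_j) ^ α_j`. -/
theorem summable_norm_monomial {d : ℕ} {b : (Fin d → ℕ) → ℂ} {ρ : Fin d → ℝ}
    (hρ : ∀ j, 0 < ρ j) {C : ℝ} (hb : ∀ α, ‖b α‖ * ∏ j, ρ j ^ α j ≤ C) {t : Fin d → ℝ}
    (h0 : ∀ j, 0 ≤ t j) (ht : ∀ j, t j < ρ j) :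
    Summable fun α => ‖b α‖ * ∏ j, t j ^ α j := by
  refine Summable.of_nonneg_of_le
    (fun α => mul_nonneg (norm_nonneg _) (Finset.prod_nonneg fun j _ => pow_nonneg (h0 j) _)) (fun α => ?_)
    ((summable_prod_pow (t := fun j => t j / ρ j) (fun j => div_nonneg (h0 j) (hρ j).le)
      fun j => (div_lt_one (hρ j)).2 (ht j)).mul_left C)
  have hp : 0 < ∏ j, ρ j ^ α j := Finset.prod_pos fun j _ => pow_pos (hρ j) _
  have : 0 ≤ ∏ j, t j ^ α j := Finset.prod_nonneg fun j _ => pow_nonneg (h0 j) _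
  simp only [div_pow, Finset.prod_div_distrib]
  rw [mul_div_assoc', le_div_iff₀ hp]
  nlinarith [hb α]

theorem isCompact_closedPolydisc {d : ℕ} (r : Fin d → ℝ) : IsCompact (closedPolydisc r) := by
  have : closedPolydisc r = Set.pi univ fun j => Metric.closedBall (0 : ℂ) (r j) := by
    ext z; simp [closedPolydisc]
  rw [this]
  exact isCompact_univ_pi fun j => isCompact_closedBall _ _

/-- Differentiating along the first basis vector keeps a function entire in all variables jointly,
so the Taylor coefficients in the first variable are entire in the others. -/
theorem iteratedDeriv_cons {d : ℕ} {F : (Fin (d + 1) → ℂ) → ℂ} (hF : AnalyticOnNhd ℂ F univ)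
    (n : ℕ) : ∃ G : (Fin (d + 1) → ℂ) → ℂ, AnalyticOnNhd ℂ G univ ∧
      ∀ z : Fin d → ℂ, iteratedDeriv n (fun w => F (Fin.cons w z)) =
        fun w => G (Fin.cons w z) := by
  induction n with
  | zero => exact ⟨F, hF, fun z => by simp⟩
  | succ n ih =>
    obtain ⟨G, hG, h⟩ := ih
    refine ⟨fun z => fderiv ℂ G z (Pi.single 0 1),
      fun z hz =>
        ((ContinuousLinearMap.apply ℂ ℂ (Pi.single 0 1 : Fin (d + 1) → ℂ)).analyticAt _).comp
          (hG.fderiv z hz), fun z => ?_⟩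
    rw [iteratedDeriv_succ, h]
    funext w
    have hc : HasDerivAt (fun w : ℂ => (Fin.cons w z : Fin (d + 1) → ℂ)) (Pi.single 0 1) w := by
      rw [hasDerivAt_pi]
      intro j
      refine Fin.cases ?_ (fun i => ?_) j
      · simpa using hasDerivAt_id' w
      · simpa using hasDerivAt_const w (z i)
    exact ((hG _ (mem_univ _)).differentiableAt.hasFDerivAt.comp_hasDerivAt w hc).deriv

/-- Induction on the dimension: Taylor expansion in the first variable, then the induction
hypothesis for its coefficients. The Cauchy bound is part of the induction because it provides the
absolute convergence needed to merge the iterated sums into one. -/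
theorem exists_powerSeries_of_entire : ∀ {d : ℕ} {F : (Fin d → ℂ) → ℂ},
    AnalyticOnNhd ℂ F univ → ∃ a : (Fin d → ℕ) → ℂ,
      (∀ ρ : Fin d → ℝ, (∀ j, 0 < ρ j) → ∀ M, (∀ z ∈ closedPolydisc ρ, ‖F z‖ ≤ M) →
        ∀ α, ‖a α‖ * ∏ j, ρ j ^ α j ≤ M) ∧
      ∀ z, HasSum (fun α => a α * ∏ j, z j ^ α j) (F z)
  | 0, F, _ => by
    refine ⟨fun _ => F 0, fun ρ _ M hM α => ?_, fun z => ?_⟩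
    · simpa using hM 0 (fun j => j.elim0)
    · simp [Subsingleton.elim z 0]
  | d + 1, F, hF => by
    choose G hG hFG using iteratedDeriv_cons hF
    have hcons : AnalyticOnNhd ℂ (fun z : Fin d → ℂ => (Fin.cons 0 z : Fin (d + 1) → ℂ)) univ := by
      intro z _
      rw [analyticAt_pi_iff]
      intro j
      refine Fin.cases ?_ (fun i => ?_) j
      · simpa using analyticAt_const
      · exact (ContinuousLinearMap.proj (R := ℂ) (φ := fun _ : Fin d => ℂ) i).analyticAt z
    have hg : ∀ n, AnalyticOnNhd ℂ
        (fun z : Fin d → ℂ => (Nat.factorial n : ℂ)⁻¹ * G n (Fin.cons 0 z)) univ := fun n z _ =>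
      analyticAt_const.mul ((hG n _ (mem_univ _)).comp (hcons z (mem_univ _)))
    choose a ha1 ha2 using fun n => exists_powerSeries_of_entire (hg n)
    have hline : ∀ z : Fin d → ℂ, Differentiable ℂ fun w : ℂ => F (Fin.cons w z) := by
      intro z w
      have hc : DifferentiableAt ℂ (fun w : ℂ => (Fin.cons w z : Fin (d + 1) → ℂ)) w := by
        rw [differentiableAt_pi]
        intro j
        refine Fin.cases ?_ (fun i => ?_) j
        · simp
        · simp
      exact (hF _ (mem_univ _)).differentiableAt.comp w hc
    have hbound : ∀ ρ : Fin (d + 1) → ℝ, (∀ j, 0 < ρ j) → ∀ M,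
        (∀ z ∈ closedPolydisc ρ, ‖F z‖ ≤ M) →
        ∀ α : Fin (d + 1) → ℕ, ‖a (α 0) (Fin.tail α)‖ * ∏ j, ρ j ^ α j ≤ M := by
      intro ρ hρ M hM α
      have hp : 0 < ρ 0 ^ α 0 := pow_pos (hρ 0) _
      have h1 := ha1 (α 0) (fun j => ρ j.succ) (fun j => hρ _) (M / ρ 0 ^ α 0) ?_ (Fin.tail α)
      · rw [le_div_iff₀ hp] at h1
        rw [Fin.prod_univ_succ]
        refine le_of_eq_of_le ?_ h1
        simp only [Fin.tail]
        ring
      -- The one-variable Cauchy inequality on `|w| = ρ 0` bounds the coefficient function on the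
      -- polydisc of the remaining radii.
      · intro z hz
        have h2 := Complex.norm_iteratedDeriv_le_of_forall_mem_sphere_norm_le (c := 0) (C := M)
          (α 0) (hρ 0) (hline z).diffContOnCl fun w hw => hM _ ?_
        · rw [hFG] at h2
          have hf : (0 : ℝ) < Nat.factorial (α 0) := by positivity
          rw [norm_mul, norm_inv, Complex.norm_natCast, inv_mul_le_iff₀ hf, mul_div_assoc']
          exact h2
        · intro j
          refine Fin.cases ?_ (fun i => ?_) j
          · simpa using (mem_sphere_iff_norm.1 hw).le
          · simpa using hz i
    refine ⟨fun α => a (α 0) (Fin.tail α), hbound, fun z => ?_⟩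
    -- Any positive radii exceeding every `|z_j|` would do.
    have hρ : ∀ j, 0 < 2 * ‖z j‖ + 1 := fun j => by positivity
    obtain ⟨M, hM⟩ := (isCompact_closedPolydisc fun j => 2 * ‖z j‖ + 1).exists_bound_of_continuousOn
      (f := F) fun z _ => (hF z (mem_univ z)).continuousAt.continuousWithinAt
    have hsum := summable_norm_monomial hρ (hbound _ hρ M hM) (t := fun j => ‖z j‖)
      (fun j => norm_nonneg _) (fun j => by linarith [norm_nonneg (z j)])
    have hsum' : Summable fun α : Fin (d + 1) → ℕ =>
        a (α 0) (Fin.tail α) * ∏ j, z j ^ α j := by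
      refine Summable.of_norm (hsum.congr fun α => ?_)
      simp [norm_prod]
    have hS := (Fin.consEquiv fun _ : Fin (d + 1) => ℕ).hasSum_iff.2 hsum'.hasSum
    -- Summing first over the tail of `α` leaves the Taylor series in the first variable, whose sum
    -- is `F z`; uniqueness identifies the total.
    have h1 := hS.prod_fiberwise
      (g := fun n => z 0 ^ n * ((Nat.factorial n : ℂ)⁻¹ * G n (Fin.cons 0 (Fin.tail z)))) ?_
    · have h2 := Complex.hasSum_taylorSeries_of_entire (hline (Fin.tail z)) 0 (z 0)
      have h3 : HasSum
          (fun n => z 0 ^ n * ((Nat.factorial n : ℂ)⁻¹ * G n (Fin.cons 0 (Fin.tail z)))) (F z) := by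
        convert! h2 using 1
        · funext n
          rw [hFG]
          simp only [sub_zero, smul_eq_mul]
          ring
        · simp
      rw [h3.unique h1]
      exact hsum'.hasSum
    · intro n
      convert! (ha2 n (Fin.tail z)).mul_left (z 0 ^ n) using 1
      funext α
      simp only [Function.comp, Fin.consEquiv, Equiv.coe_fn_mk, Fin.prod_univ_succ, Fin.cons_zero,
        Fin.cons_succ, Fin.tail_cons]
      simp only [Fin.tail]
      ring

/-- A monomial is a product over a word containing the letter `j` exactly `α j` times. This turns it
into the diagonal of a multilinear map, and later into a product of linear functionals. -/
theorem exists_word {d : ℕ} (α : Fin d → ℕ) : ∃ σ : Fin (∑ j, α j) → Fin d,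
    ∀ u : Fin d → ℂ, ∏ i, u (σ i) = ∏ j, u j ^ α j := by
  refine ⟨fun k => (finSigmaFinEquiv.symm k).1, fun u => ?_⟩
  rw [finSigmaFinEquiv.symm.prod_comp (fun x : (i : Fin d) × Fin (α i) => u x.1),
    Fintype.prod_sigma]
  simp

theorem exists_multilinear_monomial {d n : ℕ} (α : Fin d → ℕ) (h : ∑ j, α j = n) :
    ∃ m : ContinuousMultilinearMap ℂ (fun _ : Fin n => (Fin d → ℂ)) ℂ, ‖m‖ ≤ 1 ∧
      ∀ u : Fin d → ℂ, m (fun _ => u) = ∏ j, u j ^ α j := by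
  subst h
  obtain ⟨σ, hσ⟩ := exists_word α
  refine ⟨(ContinuousMultilinearMap.mkPiAlgebra ℂ (Fin (∑ j, α j)) ℂ).compContinuousLinearMap
    fun i => ContinuousLinearMap.proj (R := ℂ) (φ := fun _ : Fin d => ℂ) (σ i), ?_, fun u => ?_⟩
  · refine ContinuousMultilinearMap.opNorm_le_bound zero_le_one fun m => ?_
    simp only [ContinuousMultilinearMap.compContinuousLinearMap_apply,
      ContinuousMultilinearMap.mkPiAlgebra_apply, ContinuousLinearMap.proj_apply, one_mul, norm_prod]
    exact Finset.prod_le_prod (fun i _ => norm_nonneg _) fun i _ => norm_le_pi_norm (m i) (σ i)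
  · simpa using hσ u

theorem hasSum_fiberwise_degree {d : ℕ} {f : (Fin d → ℕ) → ℂ} {S : ℂ} (hf : HasSum f S) :
    HasSum (fun n => ∑ α ∈ Finset.univ.piAntidiag n, f α) S := by
  have h := ((Equiv.sigmaFiberEquiv fun α : Fin d → ℕ => ∑ j, α j).hasSum_iff.2 hf)
  refine h.sigma fun n => ?_
  have hset : {α : Fin d → ℕ | ∑ j, α j = n} =
      ((Finset.univ.piAntidiag n : Finset (Fin d → ℕ)) : Set (Fin d → ℕ)) := by
    ext α; simp
  have h2 := Finset.hasSum (Finset.univ.piAntidiag n : Finset (Fin d → ℕ)) f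
  let e : {α : Fin d → ℕ // ∑ j, α j = n} ≃ (Finset.univ.piAntidiag n : Finset (Fin d → ℕ)) :=
    Equiv.subtypeEquivRight fun α => by simp
  exact e.hasSum_iff.2 h2

/-- Grouping by total degree gives a formal multilinear series with `‖p n‖ ≤ ∑_{|α| = n} ‖b α‖`;
Abel's lemma then makes its radius at least 1. In the sup norm the unit ball is the unit polydisc.
-/
theorem analyticOnNhd_tsum_monomial_unit {d : ℕ} {b : (Fin d → ℕ) → ℂ} {C : ℝ}
    (hb : ∀ α, ‖b α‖ ≤ C) :
    AnalyticOnNhd ℂ (fun z : Fin d → ℂ => ∑' α, b α * ∏ j, z j ^ α j) (Metric.ball 0 1) := by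
  choose m hm1 hm2 using fun (n : ℕ) (α : {α : Fin d → ℕ // ∑ j, α j = n}) =>
    exists_multilinear_monomial α.1 α.2
  have hb' : ∀ α : Fin d → ℕ, ‖b α‖ * ∏ j, (1 : ℝ) ^ α j ≤ C := by simpa using hb
  let p : FormalMultilinearSeries ℂ (Fin d → ℂ) ℂ := fun n =>
    ∑ α ∈ (Finset.univ.piAntidiag n).attach, b α.1 • m n ⟨α.1, (Finset.mem_piAntidiag.1 α.2).1⟩
  have hp : ∀ n, ‖p n‖ ≤ ∑ α ∈ Finset.univ.piAntidiag n, ‖b α‖ := by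
    intro n
    rw [← Finset.sum_attach]
    refine (norm_sum_le _ _).trans (Finset.sum_le_sum fun α _ => ?_)
    rw [norm_smul]
    exact mul_le_of_le_one_right (norm_nonneg _) (hm1 n _)
  have hrad : 1 ≤ p.radius := by
    refine ENNReal.le_of_forall_nnreal_lt fun r hr => ?_
    have hr1 : (r : ℝ) < 1 := by exact_mod_cast hr
    have hs := summable_norm_monomial (fun _ => one_pos) hb' (t := fun _ => (r : ℝ))
      (fun _ => r.2) fun _ => hr1
    refine p.le_radius_of_bound (∑' α : Fin d → ℕ, ‖b α‖ * ∏ j, (r : ℝ) ^ α j) fun n => ?_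
    refine le_trans ?_ (hs.sum_le_tsum (Finset.univ.piAntidiag n) fun α _ => by positivity)
    refine (mul_le_mul_of_nonneg_right (hp n) (by positivity)).trans_eq ?_
    rw [Finset.sum_mul]
    refine Finset.sum_congr rfl fun α hα => ?_
    rw [Finset.prod_pow_eq_pow_sum, show ∑ j, α j = n by simpa using hα]
  have hball : HasFPowerSeriesOnBall (fun z : Fin d → ℂ => ∑' α, b α * ∏ j, z j ^ α j) p 0 1 := by
    refine ⟨hrad, one_pos, fun {y} hy => ?_⟩
    have hy1 : ‖y‖ < 1 := by
      rw [← ENNReal.ofReal_one, Metric.eball_ofReal] at hy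
      simpa using hy
    have hs := summable_norm_monomial (fun _ => one_pos) hb' (t := fun j => ‖y j‖)
      (fun _ => norm_nonneg _) fun j => (norm_le_pi_norm y j).trans_lt hy1
    have hs' : Summable fun α : Fin d → ℕ => b α * ∏ j, y j ^ α j :=
      Summable.of_norm (hs.congr fun α => by simp [norm_prod])
    rw [zero_add]
    refine (hasSum_fiberwise_degree hs'.hasSum).congr_fun fun n => ?_
    rw [← Finset.sum_attach]
    simp [p, hm2]
  have := hball.analyticOnNhd
  rwa [← ENNReal.ofReal_one, Metric.eball_ofReal] at this

theorem analyticOnNhd_tsum_monomial {d : ℕ} {b : (Fin d → ℕ) → ℂ} {ρ : Fin d → ℝ}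
    (hρ : ∀ j, 0 < ρ j) {C : ℝ} (hb : ∀ α, ‖b α‖ * ∏ j, ρ j ^ α j ≤ C) :
    AnalyticOnNhd ℂ (fun z : Fin d → ℂ => ∑' α, b α * ∏ j, z j ^ α j) (polydisc ρ) := by
  have h1 := analyticOnNhd_tsum_monomial_unit
    (b := fun α => b α * ((∏ j, ρ j ^ α j : ℝ) : ℂ)) (C := C) fun α => by
      rw [norm_mul, Complex.norm_real, Real.norm_of_nonneg
        (Finset.prod_nonneg fun j _ => pow_nonneg (hρ j).le _)]
      exact hb α
  intro z hz
  have hsc : AnalyticAt ℂ (fun z : Fin d → ℂ => fun j => z j * ((ρ j)⁻¹ : ℂ)) z := by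
    rw [analyticAt_pi_iff]
    intro j
    exact ((ContinuousLinearMap.proj (R := ℂ) (φ := fun _ : Fin d => ℂ) j).analyticAt z).mul
      analyticAt_const
  have h2 := (h1 (fun j => z j * ((ρ j)⁻¹ : ℂ)) ?_).comp hsc
  · convert! h2 using 1
    funext y
    simp only [Function.comp]
    refine tsum_congr fun α => ?_
    rw [mul_assoc]
    congr 1
    push_cast
    rw [← Finset.prod_mul_distrib]
    refine Finset.prod_congr rfl fun j _ => ?_
    have : (ρ j : ℂ) ≠ 0 := by exact_mod_cast (hρ j).ne'
    rw [← mul_pow]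
    congr 1
    field_simp
  · rw [mem_ball_zero_iff, pi_norm_lt_iff one_pos]
    intro j
    rw [norm_mul, norm_inv, Complex.norm_real, Real.norm_of_nonneg (hρ j).le,
      mul_inv_lt_iff₀ (hρ j), one_mul]
    exact hz j


/-! ### Growth of the elements of `𝒜_{♭₁}` -/

theorem mem_spaceAFlatOne_iff {d : ℕ} {F : (Fin d → ℂ) → ℂ} :
    F ∈ spaceAFlatOne d ↔ ∃ a : (Fin d → ℕ) → ℂ,
      (∃ r : Fin d → ℝ, (∀ j, 0 < r j) ∧ ∃ C : ℝ, ∀ α,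
        ‖a α‖ ≤ C * ∏ j, r j ^ α j / (Nat.factorial (α j) : ℝ)) ∧
      ∀ z, HasSum (fun α => a α * ∏ j, z j ^ α j) (F z) := by
  have hpos : ∀ α : Fin d → ℕ, 0 < ∏ j, (Nat.factorial (α j) : ℝ) := fun α =>
    Finset.prod_pos fun j _ => by positivity
  have hsq : ∀ α : Fin d → ℕ, √(∏ j, (Nat.factorial (α j) : ℝ)) *
      √(∏ j, (Nat.factorial (α j) : ℝ)) = ∏ j, (Nat.factorial (α j) : ℝ) := fun α =>
    Real.mul_self_sqrt (hpos α).le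
  have hs0 : ∀ α : Fin d → ℕ, 0 < √(∏ j, (Nat.factorial (α j) : ℝ)) := fun α =>
    Real.sqrt_pos.2 (hpos α)
  constructor
  · rintro ⟨c, ⟨r, hr, C, hc⟩, hF⟩
    refine ⟨fun α => c α / (√(∏ j, (Nat.factorial (α j) : ℝ)) : ℝ), ⟨r, hr, C, fun α => ?_⟩,
      fun z => (hF z).congr_fun fun α => ?_⟩
    · rw [norm_div, Complex.norm_real, Real.norm_of_nonneg (hs0 α).le, div_le_iff₀ (hs0 α)]
      refine (hc α).trans_eq ?_
      have e := (hsq α).symm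
      have h0 := (hs0 α).ne'
      generalize √(∏ j, (Nat.factorial (α j) : ℝ)) = q at e h0 ⊢
      rw [Finset.prod_div_distrib, e]
      field_simp
    · simp only [monomialA]
      ring
  · rintro ⟨a, ⟨r, hr, C, ha⟩, hF⟩
    refine ⟨fun α => a α * (√(∏ j, (Nat.factorial (α j) : ℝ)) : ℝ), ⟨r, hr, C, fun α => ?_⟩,
      fun z => (hF z).congr_fun fun α => ?_⟩
    · rw [norm_mul, Complex.norm_real, Real.norm_of_nonneg (hs0 α).le, ← le_div_iff₀ (hs0 α)]
      refine (ha α).trans_eq ?_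
      have e := (hsq α).symm
      have h0 := (hs0 α).ne'
      generalize √(∏ j, (Nat.factorial (α j) : ℝ)) = q at e h0 ⊢
      rw [Finset.prod_div_distrib, e]
      field_simp
    · simp only [monomialA]
      have : ((√(∏ j, (Nat.factorial (α j) : ℝ)) : ℝ) : ℂ) ≠ 0 := by exact_mod_cast (hs0 α).ne'
      field_simp

theorem exp_bound_of_mem_spaceAFlatOne {d : ℕ} {F : (Fin d → ℂ) → ℂ} (hF : F ∈ spaceAFlatOne d) :
    ∃ r : Fin d → ℝ, (∀ j, 0 < r j) ∧ ∃ C : ℝ, ∀ z, ‖F z‖ ≤ C * Real.exp (∑ j, r j * ‖z j‖) := by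
  obtain ⟨a, ⟨r, hr, C, ha⟩, hsum⟩ := mem_spaceAFlatOne_iff.1 hF
  refine ⟨r, hr, C, fun z => ?_⟩
  rw [← (hsum z).tsum_eq]
  refine tsum_of_norm_bounded ((hasSum_prod_real_exp fun j => r j * ‖z j‖).mul_left C) fun α => ?_
  rw [norm_mul, norm_prod]
  refine (mul_le_mul_of_nonneg_right (ha α) (by positivity)).trans_eq ?_
  rw [mul_assoc, ← Finset.prod_mul_distrib]
  congr 1
  refine Finset.prod_congr rfl fun j _ => ?_
  rw [norm_pow, mul_pow]
  ring

theorem mem_spaceAFlatOne_of_exp_bound {d : ℕ} {F : (Fin d → ℂ) → ℂ}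
    (hF : AnalyticOnNhd ℂ F univ) {r : Fin d → ℝ} (hr : ∀ j, 0 < r j) {C : ℝ}
    (hC : ∀ z, ‖F z‖ ≤ C * Real.exp (∑ j, r j * ‖z j‖)) : F ∈ spaceAFlatOne d := by
  obtain ⟨a, ha, hsum⟩ := exists_powerSeries_of_entire hF
  have hC0 : 0 ≤ C := by
    have := (norm_nonneg _).trans (hC 0)
    exact nonneg_of_mul_nonneg_left this (Real.exp_pos _)
  refine mem_spaceAFlatOne_iff.2 ⟨a, ⟨fun j => Real.exp 1 * r j,
    fun j => mul_pos (Real.exp_pos _) (hr j), C * Real.exp 1 ^ d, fun α => ?_⟩, hsum⟩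
  -- Up to the shift by one, these radii minimize `exp (r_j ρ_j) / ρ_j ^ α_j`. The shift keeps them
  -- positive when `α j = 0` and costs the factor `exp 1 ^ d`.
  have hρ : ∀ j, 0 < ((α j : ℝ) + 1) / r j := fun j => div_pos (by positivity) (hr j)
  have h1 := ha _ hρ (C * ∏ j, Real.exp ((α j : ℝ) + 1)) (fun z hz => ?_) α
  · have hp : 0 < ∏ j, (((α j : ℝ) + 1) / r j) ^ α j := Finset.prod_pos fun j _ => pow_pos (hρ j) _
    rw [← le_div_iff₀ hp] at h1
    refine h1.trans ?_
    rw [mul_div_assoc, mul_assoc, ← Finset.prod_div_distrib]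
    refine mul_le_mul_of_nonneg_left ?_ hC0
    have hd : Real.exp 1 ^ d = ∏ _j : Fin d, Real.exp 1 := by simp
    rw [hd, ← Finset.prod_mul_distrib]
    refine Finset.prod_le_prod (fun j _ => div_nonneg (Real.exp_pos _).le (pow_pos (hρ j) _).le)
      fun j _ => ?_
    have h2 : (Nat.factorial (α j) : ℝ) ≤ ((α j : ℝ) + 1) ^ α j := by
      exact_mod_cast (Nat.factorial_le_pow (α j)).trans (Nat.pow_le_pow_left (Nat.le_succ _) _)
    have h3 : (0 : ℝ) < Nat.factorial (α j) := by positivity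
    have h4 : 0 < r j ^ α j := pow_pos (hr j) _
    have h5 : Real.exp ((α j : ℝ) + 1) = Real.exp 1 * Real.exp 1 ^ α j := by
      rw [Real.exp_add, ← Real.exp_nat_mul, mul_one, mul_comm]
    calc Real.exp ((α j : ℝ) + 1) / (((α j : ℝ) + 1) / r j) ^ α j
        = Real.exp 1 * (Real.exp 1 * r j) ^ α j / ((α j : ℝ) + 1) ^ α j := by
          rw [h5, div_pow, mul_pow]
          field_simp
      _ ≤ Real.exp 1 * (Real.exp 1 * r j) ^ α j / (Nat.factorial (α j) : ℝ) := by
          have := hr j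
          gcongr
      _ = _ := by ring
  · refine (hC z).trans (mul_le_mul_of_nonneg_left ?_ hC0)
    rw [← Real.exp_sum]
    refine Real.exp_le_exp.2 (Finset.sum_le_sum fun j _ => ?_)
    have := hz j
    rw [le_div_iff₀ (hr j)] at this
    linarith

/-! ### Cutoffs, bounded functions and Gevrey distributions -/

theorem measurableSet_closedPolydisc {d : ℕ} (r : Fin d → ℝ) :
    MeasurableSet (closedPolydisc r) := (isCompact_closedPolydisc r).measurableSet

theorem isRadialCutoff_indicator {d : ℕ} {t r : Fin d → ℝ} (h : ∀ j, t j ≤ r j) :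
    IsRadialCutoff t r ((closedPolydisc r).indicator fun _ => 1) where
  memLp := MemLp.indicator (measurableSet_closedPolydisc r) (memLp_top_const 1)
  nonneg := Filter.Eventually.of_forall fun z => indicator_nonneg (fun _ _ => zero_le_one) z
  support := Filter.Eventually.of_forall fun z hz => indicator_of_notMem hz _
  radial := ⟨fun x => open Classical in if ∀ j, x j ≤ r j then 1 else 0,
    Filter.Eventually.of_forall fun z => by
      by_cases hz : z ∈ closedPolydisc r
      · exact (indicator_of_mem hz _).trans (if_pos hz).symm
      · exact (indicator_of_notMem hz _).trans (if_neg hz).symm⟩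
  lower := ⟨1, one_pos, Filter.Eventually.of_forall fun z hz => by
    rw [indicator_of_mem]
    exact fun j => (hz j).le.trans (h j)⟩

/-- Nothing is known about `F` off `K`, so it is replaced by its restriction to `K`, which does not
change the product almost everywhere. -/
theorem memLp_top_mul_of_continuousOn {d : ℕ} {K : Set (Fin d → ℂ)} (hK : IsCompact K)
    {F G : (Fin d → ℂ) → ℂ} (hF : ContinuousOn F K) (hG : MemLp G ⊤ volume)
    (hs : ∀ᵐ z, z ∉ K → G z = 0) : MemLp (fun z => F z * G z) ⊤ volume := by
  obtain ⟨M, hM⟩ := hK.exists_bound_of_continuousOn hF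
  have h1 : MemLp (K.indicator F) ⊤ volume := by
    refine memLp_top_of_bound
      ((aestronglyMeasurable_indicator_iff hK.measurableSet).2
        (hF.aestronglyMeasurable hK.measurableSet)) (max M 0)
      (Filter.Eventually.of_forall fun z => ?_)
    by_cases hz : z ∈ K
    · rw [indicator_of_mem hz]
      exact (hM z hz).trans (le_max_left _ _)
    · rw [indicator_of_notMem hz, norm_zero]
      exact le_max_right _ _
  have h2 : MemLp (K.indicator F * G) ⊤ volume := hG.mul h1
  refine h2.ae_eq ?_
  filter_upwards [hs] with z hz
  by_cases hzK : z ∈ K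
  · simp [hzK]
  · simp [hz hzK]

theorem integrable_of_mem_boundedCompact {d : ℕ} {F : (Fin d → ℂ) → ℂ}
    (hF : F ∈ boundedCompact d) : Integrable F := by
  obtain ⟨h1, K, hK, h2⟩ := hF
  have : IsFiniteMeasure (volume.restrict K) :=
    ⟨by rw [Measure.restrict_apply_univ]; exact hK.measure_lt_top⟩
  have h3 : IntegrableOn F K := (h1.restrict K).integrable le_top
  exact h3.integrable_of_ae_notMem_eq_zero h2

theorem mul_mem_boundedCompact {d : ℕ} {F G : (Fin d → ℂ) → ℂ} (hG : G ∈ boundedCompact d)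
    (hF : Continuous F) : (fun z => F z * G z) ∈ boundedCompact d := by
  obtain ⟨h1, K, hK, h2⟩ := hG
  refine ⟨memLp_top_mul_of_continuousOn hK hF.continuousOn h1 h2, K, hK, ?_⟩
  filter_upwards [h2] with z hz hzK
  rw [hz hzK, mul_zero]

theorem mul_cutoff_mem_boundedCompact {d : ℕ} {t r : Fin d → ℝ} {χ : (Fin d → ℂ) → ℝ}
    (hχ : IsRadialCutoff t r χ) {F : (Fin d → ℂ) → ℂ} (hF : ContinuousOn F (closedPolydisc r)) :
    (fun w => F w * (χ w : ℂ)) ∈ boundedCompact d := by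
  have h0 : ∀ᵐ z, z ∉ closedPolydisc r → (χ z : ℂ) = 0 := by
    filter_upwards [hχ.support] with z hz hzr
    rw [hz hzr, Complex.ofReal_zero]
  refine ⟨memLp_top_mul_of_continuousOn (isCompact_closedPolydisc r) hF hχ.memLp.ofReal h0,
    closedPolydisc r, isCompact_closedPolydisc r, ?_⟩
  filter_upwards [h0] with z hz hzr
  rw [hz hzr, mul_zero]

theorem analyticCompact_subset_boundedCompact (d : ℕ) :
    analyticCompact d ⊆ boundedCompact d := by
  rintro _ ⟨K, hK, F, hF, rfl⟩
  have h : ∀ᵐ z : Fin d → ℂ, z ∉ K → K.indicator (fun _ => (1 : ℂ)) z = 0 :=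
    Filter.Eventually.of_forall fun z hz => indicator_of_notMem hz _
  have h1 := memLp_top_mul_of_continuousOn hK hF.continuousOn
    (MemLp.indicator hK.measurableSet (memLp_top_const 1)) h
  refine ⟨?_, K, hK, Filter.Eventually.of_forall fun z hz => indicator_of_notMem hz _⟩
  convert! h1 using 1
  funext z
  by_cases hz : z ∈ K <;> simp [hz]

/-- Integration against `F` has order zero: only the bound for `k = 0` enters, and the constant `∫
‖F‖` serves every `h`. -/
theorem exists_gevreyDual_of_mem_boundedCompact {d : ℕ} {s : ℝ} (hs : 1 < s)
    {F : (Fin d → ℂ) → ℂ} (hF : F ∈ boundedCompact d) :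
    ∃ u ∈ gevreyDual d s, projA F = projADual hs u := by
  have hint : ∀ φ : gevreySpace d s, Integrable fun w => F w * (φ : (Fin d → ℂ) → ℂ) w :=
    fun φ => by
      simpa only [mul_comm] using
        integrable_of_mem_boundedCompact (mul_mem_boundedCompact hF φ.2.1.continuous)
  let u : gevreySpace d s →ₗ[ℂ] ℂ :=
    { toFun := fun φ => ∫ w, F w * (φ : (Fin d → ℂ) → ℂ) w
      map_add' := fun φ ψ => by
        rw [← integral_add (hint φ) (hint ψ)]
        simp [mul_add]
      map_smul' := fun a φ => by
        rw [RingHom.id_apply, smul_eq_mul, ← integral_const_mul]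
        simp [mul_left_comm] }
  refine ⟨u, ?_, rfl⟩
  obtain ⟨h1, K, hK, h2⟩ := id hF
  refine ⟨K, hK, fun h hh => ⟨∫ w, ‖F w‖, fun φ M hM H => ?_⟩⟩
  change ‖∫ w, F w * (φ : (Fin d → ℂ) → ℂ) w‖ ≤ _
  rw [← integral_mul_const]
  refine norm_integral_le_of_norm_le ((integrable_of_mem_boundedCompact hF).norm.mul_const M) ?_
  filter_upwards [h2] with w hw
  rw [norm_mul]
  by_cases hwK : w ∈ K
  · have := H 0 w hwK
    simp only [norm_iteratedFDeriv_zero, pow_zero, Nat.factorial_zero, Nat.cast_one,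
      Real.one_rpow, mul_one] at this
    gcongr
  · simp [hw hwK]


/-! ### Images of radially cut off power series -/

theorem bargmannKernel_eq_mul {d : ℕ} (z w : Fin d → ℂ) :
    bargmannKernel z w = Complex.exp (∑ j, z j * conj (w j)) * bargmannKernel 0 w := by
  simp [bargmannKernel, ← Complex.exp_add, sub_eq_add_neg]

theorem bargmannKernel_zero_eq {d : ℕ} (w : Fin d → ℂ) :
    bargmannKernel 0 w = (Real.exp (-∑ j, ‖w j‖ ^ 2) : ℝ) := by
  simp [bargmannKernel]

theorem continuous_bargmannKernel {d : ℕ} (z : Fin d → ℂ) : Continuous (bargmannKernel z) := by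
  unfold bargmannKernel
  fun_prop

theorem continuous_monomial {d : ℕ} (α : Fin d → ℕ) :
    Continuous fun w : Fin d → ℂ => ∏ j, w j ^ α j := by fun_prop

theorem hasSum_integral_mul {d : ℕ} {ι : Type*} [Countable ι] {K : Set (Fin d → ℂ)}
    {G : (Fin d → ℂ) → ℂ} (hG : Integrable G) (hs : ∀ᵐ w, w ∉ K → G w = 0)
    {f : ι → (Fin d → ℂ) → ℂ} (hf : ∀ i, Continuous (f i)) {v : ι → ℝ} (hv : Summable v)
    (hb : ∀ i, ∀ w ∈ K, ‖f i w‖ ≤ v i) :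
    HasSum (fun i => ∫ w, f i w * G w) (∫ w, (∑' i, f i w) * G w) := by
  have hle : ∀ i, ∀ᵐ w, ‖f i w * G w‖ ≤ v i * ‖G w‖ := fun i => by
    filter_upwards [hs] with w hw
    by_cases hwK : w ∈ K
    · rw [norm_mul]
      exact mul_le_mul_of_nonneg_right (hb i w hwK) (norm_nonneg _)
    · simp [hw hwK]
  have hint : ∀ i, Integrable fun w => f i w * G w := fun i =>
    (hG.norm.const_mul (v i)).mono' ((hf i).aestronglyMeasurable.mul hG.1) (hle i)
  have h := hasSum_integral_of_summable_integral_norm hint ?_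
  · simpa only [tsum_mul_right] using h
  · refine Summable.of_nonneg_of_le (fun i => integral_nonneg fun w => norm_nonneg _) (fun i => ?_)
      (hv.mul_right (∫ w, ‖G w‖))
    rw [← integral_const_mul]
    exact integral_mono_ae (hint i).norm (hG.norm.const_mul (v i)) (hle i)

theorem measurePreserving_rotate {d : ℕ} (a : Fin d → Circle) :
    MeasurePreserving (fun (w : Fin d → ℂ) j => (a j : ℂ) * w j) := by
  refine volume_preserving_pi fun j => ?_
  have := (rotation (a j)).measurePreserving
  convert! this using 1

/-- The moments of a cutoff with respect to the Gaussian weight. -/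
noncomputable def moment {d : ℕ} (χ : (Fin d → ℂ) → ℝ) (α : Fin d → ℕ) : ℝ :=
  ∫ w, (∏ j, ‖w j‖ ^ (2 * α j)) * (χ w * Real.exp (-∑ j, ‖w j‖ ^ 2))

section Cutoff

variable {d : ℕ} {t r : Fin d → ℝ} {χ : (Fin d → ℂ) → ℝ}

theorem integrable_mul_cutoff (hχ : IsRadialCutoff t r χ) {f : (Fin d → ℂ) → ℂ}
    (hf : Continuous f) : Integrable fun w => f w * (χ w : ℂ) :=
  integrable_of_mem_boundedCompact (mul_cutoff_mem_boundedCompact hχ hf.continuousOn)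

theorem integral_monomial_mul_conj_of_ne (hχ : IsRadialCutoff t r χ) {α β : Fin d → ℕ}
    (h : α ≠ β) :
    ∫ w, (∏ j, w j ^ α j) * (∏ j, conj (w j) ^ β j) * bargmannKernel 0 w * (χ w : ℂ) = 0 := by
  obtain ⟨k, hk⟩ := Function.ne_iff.1 h
  have hk' : (α k : ℂ) - (β k : ℂ) ≠ 0 := sub_ne_zero.2 (by exact_mod_cast hk)
  -- Rotating the `k`-th coordinate by `π / (α k - β k)` multiplies the integrand by `exp (iπ) =
  -- -1`, while the cutoff, the Gaussian and the measure are invariant; the integral equals its own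
  -- negative.
  set a : Fin d → Circle := Pi.mulSingle k (Circle.exp (Real.pi / ((α k : ℝ) - β k))) with ha
  set H : (Fin d → ℂ) → ℂ := fun w =>
    (∏ j, w j ^ α j) * (∏ j, conj (w j) ^ β j) * bargmannKernel 0 w * (χ w : ℂ) with hH
  have hHint : Integrable H := integrable_mul_cutoff hχ
    (((continuous_monomial α).mul (by fun_prop)).mul (continuous_bargmannKernel 0))
  have hT := measurePreserving_rotate a
  have h1 : ∫ w, H w = ∫ w : Fin d → ℂ, H (fun j => (a j : ℂ) * w j) := by
    conv_lhs => rw [← hT.map_eq]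
    exact integral_map hT.measurable.aemeasurable (by rw [hT.map_eq]; exact hHint.1)
  have hrot : (∏ j, (a j : ℂ) ^ α j) * (∏ j, conj (a j : ℂ) ^ β j) = -1 := by
    rw [Finset.prod_eq_single k, Finset.prod_eq_single k]
    · rw [ha, Pi.mulSingle_eq_same, Circle.coe_exp, ← Complex.exp_conj, ← Complex.exp_nat_mul,
        ← Complex.exp_nat_mul, ← Complex.exp_add, ← Complex.exp_pi_mul_I]
      congr 1
      simp only [map_mul, Complex.conj_ofReal, Complex.conj_I]
      push_cast
      field_simp
      ring
    · intro j _ hj; simp [ha, Pi.mulSingle_eq_of_ne hj]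
    · simp
    · intro j _ hj; simp [ha, Pi.mulSingle_eq_of_ne hj]
    · simp
  have h2 : ∫ w : Fin d → ℂ, H (fun j => (a j : ℂ) * w j) = ∫ w, -1 * H w := by
    obtain ⟨χ₀, hχ₀⟩ := hχ.radial
    refine integral_congr_ae ?_
    filter_upwards [hχ₀, hT.quasiMeasurePreserving.ae hχ₀] with w hw1 hw2
    have e : χ (fun j => (a j : ℂ) * w j) = χ w := by
      simp only [hw1, hw2, norm_mul, Circle.norm_coe, one_mul]
    simp only [hH, e, mul_pow, Finset.prod_mul_distrib, map_mul, bargmannKernel_zero_eq, norm_mul,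
      Circle.norm_coe, one_mul]
    rw [← hrot]
    ring
  rw [integral_const_mul, ← h1] at h2
  linear_combination (1 / 2 : ℂ) * h2

theorem integral_monomial_mul_conj_self (α : Fin d → ℕ) :
    ∫ w, (∏ j, w j ^ α j) * (∏ j, conj (w j) ^ α j) * bargmannKernel 0 w * (χ w : ℂ) =
      (moment χ α : ℂ) := by
  rw [moment, ← integral_complex_ofReal]
  refine integral_congr_ae (Filter.Eventually.of_forall fun w => ?_)
  simp only [← Finset.prod_mul_distrib, ← mul_pow, Complex.mul_conj', bargmannKernel_zero_eq]
  push_cast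
  simp only [← pow_mul]
  ring

/-- In the expansion of `exp (z, w)` into powers of `conj w`, orthogonality leaves only the term
with exponent `α`. -/
theorem integral_monomial_mul_kernel (hχ : IsRadialCutoff t r χ)
    (α : Fin d → ℕ) (z : Fin d → ℂ) :
    ∫ w, (∏ j, w j ^ α j) * (bargmannKernel z w * (χ w : ℂ)) =
      (∏ j, z j ^ α j / (Nat.factorial (α j) : ℂ)) * (moment χ α : ℂ) := by
  set G : (Fin d → ℂ) → ℂ := fun w => ((∏ j, w j ^ α j) * bargmannKernel 0 w) * (χ w : ℂ) with hG
  have hGint : Integrable G := integrable_mul_cutoff hχ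
    ((continuous_monomial α).mul (continuous_bargmannKernel 0))
  have hGs : ∀ᵐ w, w ∉ closedPolydisc r → G w = 0 := by
    filter_upwards [hχ.support] with w hw hwr
    simp [hG, hw hwr]
  have hcont : ∀ β : Fin d → ℕ, Continuous fun w : Fin d → ℂ =>
      ∏ j, (z j * conj (w j)) ^ β j / (Nat.factorial (β j) : ℂ) := fun β => by fun_prop
  have hsum := hasSum_integral_mul hGint hGs hcont
    (hasSum_prod_real_exp fun j => ‖z j‖ * r j).summable fun β w hw => by
      simp only [norm_prod, norm_div, norm_pow, norm_mul, Complex.norm_natCast, RCLike.norm_conj]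
      refine Finset.prod_le_prod (fun j _ => by positivity) fun j _ => ?_
      have := hw j
      gcongr
  have hexp : ∀ w : Fin d → ℂ,
      ∑' β : Fin d → ℕ, ∏ j, (z j * conj (w j)) ^ β j / (Nat.factorial (β j) : ℂ) =
        Complex.exp (∑ j, z j * conj (w j)) := fun w => (hasSum_prod_exp _).2.tsum_eq
  have hterm : ∀ β : Fin d → ℕ,
      ∫ w, (∏ j, (z j * conj (w j)) ^ β j / (Nat.factorial (β j) : ℂ)) * G w =
        (∏ j, z j ^ β j / (Nat.factorial (β j) : ℂ)) *
        ∫ w, (∏ j, w j ^ α j) * (∏ j, conj (w j) ^ β j) * bargmannKernel 0 w * (χ w : ℂ) := by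
    intro β
    rw [← integral_const_mul]
    congr 1
    funext w
    simp only [hG, mul_pow, Finset.prod_mul_distrib, Finset.prod_div_distrib]
    ring
  have hone : HasSum (fun β : Fin d → ℕ =>
      ∫ w, (∏ j, (z j * conj (w j)) ^ β j / (Nat.factorial (β j) : ℂ)) * G w)
      ((∏ j, z j ^ α j / (Nat.factorial (α j) : ℂ)) * (moment χ α : ℂ)) := by
    rw [← integral_monomial_mul_conj_self, ← hterm]
    refine hasSum_single α fun β hβ => ?_
    rw [hterm, integral_monomial_mul_conj_of_ne hχ hβ.symm, mul_zero]
  rw [← hsum.unique hone]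
  congr 1
  funext w
  rw [hexp, bargmannKernel_eq_mul z w]
  simp only [hG]
  ring

theorem hasSum_projA_powerSeries (hχ : IsRadialCutoff t r χ)
    {b : (Fin d → ℕ) → ℂ} (hb : Summable fun α => ‖b α‖ * ∏ j, r j ^ α j) (z : Fin d → ℂ) :
    HasSum (fun α => ((Real.pi : ℂ) ^ d)⁻¹ *
        (b α * ((∏ j, z j ^ α j / (Nat.factorial (α j) : ℂ)) * (moment χ α : ℂ))))
      (projA (fun w => (∑' α, b α * ∏ j, w j ^ α j) * (χ w : ℂ)) z) := by
  have hGs : ∀ᵐ w, w ∉ closedPolydisc r → bargmannKernel z w * (χ w : ℂ) = 0 := by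
    filter_upwards [hχ.support] with w hw hwr
    simp [hw hwr]
  have hsum := hasSum_integral_mul (integrable_mul_cutoff hχ (continuous_bargmannKernel z)) hGs
    (f := fun α w => b α * ∏ j, w j ^ α j)
    (fun α => continuous_const.mul (continuous_monomial α)) hb fun α w hw => by
      rw [norm_mul, norm_prod]
      simp only [norm_pow]
      refine mul_le_mul_of_nonneg_left ?_ (norm_nonneg _)
      refine Finset.prod_le_prod (fun j _ => by positivity) fun j _ => ?_
      have := hw j
      gcongr
  have h := hsum.mul_left ((Real.pi : ℂ) ^ d)⁻¹
  convert! h using 1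
  · funext α
    rw [← integral_monomial_mul_kernel hχ, ← integral_const_mul]
    simp only [mul_assoc]
  · rw [projA]
    congr 2
    funext w
    ring

/-- It suffices to integrate over the product of annuli `q_j < |w_j| < t_j`, of positive measure,
where `χ ≥ c` and the Gaussian is at least `exp (-∑ t_j²)`. -/
theorem exists_moment_lower_bound (hχ : IsRadialCutoff t r χ) {q : Fin d → ℝ}
    (hq : ∀ j, 0 < q j) (hqt : ∀ j, q j < t j) :
    ∃ c : ℝ, 0 < c ∧ ∀ α, c * ∏ j, q j ^ (2 * α j) ≤ moment χ α := by
  obtain ⟨c, hc, hlow⟩ := hχ.lower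
  set A : Set (Fin d → ℂ) := {w | ∀ j, q j < ‖w j‖ ∧ ‖w j‖ < t j} with hA
  have hAo : IsOpen A := by
    have : A = Set.pi univ fun j => {w : ℂ | q j < ‖w‖ ∧ ‖w‖ < t j} := by
      ext w; simp [hA]
    rw [this]
    exact isOpen_set_pi finite_univ fun j _ =>
      (isOpen_lt continuous_const continuous_norm).inter (isOpen_lt continuous_norm continuous_const)
  have hAne : A.Nonempty := by
    refine ⟨fun j => (((q j + t j) / 2 : ℝ) : ℂ), fun j => ?_⟩
    have h1 := hq j
    have h2 := hqt j
    rw [Complex.norm_real, Real.norm_of_nonneg (by linarith)]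
    constructor <;> linarith
  have hAfin : volume A ≠ ⊤ := by
    refine ((measure_mono (t := closedPolydisc t) ?_).trans_lt
      (isCompact_closedPolydisc t).measure_lt_top).ne
    exact fun w hw j => (hw j).2.le
  have hApos : 0 < volume.real A :=
    ENNReal.toReal_pos (hAo.measure_pos volume hAne).ne' hAfin
  refine ⟨volume.real A * (c * Real.exp (-∑ j, t j ^ 2)), by positivity, fun α => ?_⟩
  have hint : Integrable fun w => (∏ j, ‖w j‖ ^ (2 * α j)) *
      (χ w * Real.exp (-∑ j, ‖w j‖ ^ 2)) := by
    have h := (integrable_mul_cutoff hχ (f := fun w : Fin d → ℂ =>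
      (((∏ j, ‖w j‖ ^ (2 * α j)) * Real.exp (-∑ j, ‖w j‖ ^ 2) : ℝ) : ℂ)) (by fun_prop)).re
    refine h.congr (Filter.Eventually.of_forall fun w => ?_)
    beta_reduce
    rw [← Complex.ofReal_mul, RCLike.re_eq_complex_re, Complex.ofReal_re]
    ring
  have hle : A.indicator (fun _ => (∏ j, q j ^ (2 * α j)) * (c * Real.exp (-∑ j, t j ^ 2)))
      ≤ᵐ[volume] fun w => (∏ j, ‖w j‖ ^ (2 * α j)) * (χ w * Real.exp (-∑ j, ‖w j‖ ^ 2)) := by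
    filter_upwards [hlow, hχ.nonneg] with w hw hw0
    by_cases hwA : w ∈ A
    · rw [indicator_of_mem hwA]
      have hcw := hw fun j => (hwA j).2
      have h1 : ∏ j, q j ^ (2 * α j) ≤ ∏ j, ‖w j‖ ^ (2 * α j) :=
        Finset.prod_le_prod (fun j _ => pow_nonneg (hq j).le _) fun j _ =>
          pow_le_pow_left₀ (hq j).le (hwA j).1.le _
      have h2 : ∑ j, ‖w j‖ ^ 2 ≤ ∑ j, t j ^ 2 := Finset.sum_le_sum fun j _ =>
        pow_le_pow_left₀ (norm_nonneg _) (hwA j).2.le _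
      gcongr
    · rw [indicator_of_notMem hwA]
      positivity
  have := integral_mono_ae
    ((integrable_indicator_iff hAo.measurableSet).2 (integrableOn_const hAfin)) hint hle
  rw [integral_indicator hAo.measurableSet, setIntegral_const, smul_eq_mul] at this
  refine le_of_eq_of_le ?_ this
  ring

end Cutoff

theorem exists_analytic_preimage {d : ℕ} {F : (Fin d → ℂ) → ℂ} (hF : F ∈ spaceAFlatOne d) :
    ∃ ρ : Fin d → ℝ, (∀ j, 0 < ρ j) ∧ ∀ r : Fin d → ℝ, (∀ j, ρ j ≤ r j) →
      ∃ r₀ : Fin d → ℝ, (∀ j, 0 < r₀ j ∧ r₀ j < r j) ∧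
        ∀ χ : (Fin d → ℂ) → ℝ, IsRadialCutoff r₀ r χ →
          ∃ F₀ : (Fin d → ℂ) → ℂ, AnalyticOnNhd ℂ F₀ (closedPolydisc r) ∧
            F = projA (fun w => F₀ w * (χ w : ℂ)) := by
  obtain ⟨a, ⟨R, hR, C, ha⟩, hsum⟩ := mem_spaceAFlatOne_iff.1 hF
  refine ⟨fun j => 2 * R j, fun j => by linarith [hR j], fun r hr => ?_⟩
  have hrR : ∀ j, R j < r j := fun j => by linarith [hR j, hr j]
  have hr0 : ∀ j, 0 < r j := fun j => (hR j).trans (hrR j)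
  -- The inner radius lies halfway between `q = (r + R) / 2` and `r`, leaving room for the moment
  -- bound at `q`.
  refine ⟨fun j => ((r j + R j) / 2 + r j) / 2,
    fun j => ⟨by linarith [hR j, hr0 j], by linarith [hrR j]⟩, fun χ hχ => ?_⟩
  obtain ⟨c, hc, hm⟩ := exists_moment_lower_bound hχ (q := fun j => (r j + R j) / 2)
    (fun j => by linarith [hR j, hr0 j]) (fun j => by linarith [hrR j])
  have hq : ∀ j, 0 < (r j + R j) / 2 := fun j => by linarith [hR j, hr0 j]
  have hqp : ∀ α : Fin d → ℕ, 0 < ∏ j, ((r j + R j) / 2) ^ (2 * α j) := fun α =>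
    Finset.prod_pos fun j _ => pow_pos (hq j) _
  have hmpos : ∀ α, 0 < moment χ α := fun α => (mul_pos hc (hqp α)).trans_le (hm α)
  set b : (Fin d → ℕ) → ℂ := fun α =>
    (Real.pi : ℂ) ^ d * a α * (∏ j, (Nat.factorial (α j) : ℂ)) / (moment χ α : ℂ) with hb
  set σ : Fin d → ℝ := fun j => ((r j + R j) / 2) ^ 2 / R j with hσ
  have hσ0 : ∀ j, 0 < σ j := fun j => div_pos (pow_pos (hq j) 2) (hR j)
  -- The inequality `q² > r R` is the strict arithmetic-geometric mean inequality, from `R j < r j`.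
  have hrσ : ∀ j, r j < σ j := fun j => by
    rw [hσ, lt_div_iff₀ (hR j)]
    nlinarith [sq_pos_of_pos (sub_pos.2 (hrR j))]
  have hfac : ∀ α : Fin d → ℕ, 0 < ∏ j, (Nat.factorial (α j) : ℝ) := fun α =>
    Finset.prod_pos fun j _ => by positivity
  have hbb : ∀ α, ‖b α‖ * ∏ j, σ j ^ α j ≤ Real.pi ^ d * C / c := by
    intro α
    have e1 : ‖b α‖ = Real.pi ^ d * ‖a α‖ * (∏ j, (Nat.factorial (α j) : ℝ)) / moment χ α := by
      rw [hb, norm_div, norm_mul, norm_mul, norm_pow, norm_prod, Complex.norm_real,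
        Complex.norm_real, Real.norm_of_nonneg Real.pi_pos.le, Real.norm_of_nonneg (hmpos α).le]
      simp
    have e2 : ∏ j, σ j ^ α j = (∏ j, ((r j + R j) / 2) ^ (2 * α j)) / ∏ j, R j ^ α j := by
      rw [← Finset.prod_div_distrib]
      exact Finset.prod_congr rfl fun j _ => by rw [hσ, div_pow, ← pow_mul]
    have hRp : 0 < ∏ j, R j ^ α j := Finset.prod_pos fun j _ => pow_pos (hR j) _
    have h1 : ‖a α‖ * (∏ j, (Nat.factorial (α j) : ℝ)) ≤ C * ∏ j, R j ^ α j := by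
      rw [← le_div_iff₀ (hfac α)]
      refine (ha α).trans_eq ?_
      rw [Finset.prod_div_distrib, mul_div_assoc]
    have hC : 0 ≤ C * ∏ j, R j ^ α j := le_trans (mul_nonneg (norm_nonneg _) (hfac α).le) h1
    rw [e1, e2, div_mul_div_comm, div_le_div_iff₀ (mul_pos (hmpos α) hRp) hc]
    calc _ = Real.pi ^ d * (‖a α‖ * (∏ j, (Nat.factorial (α j) : ℝ))) *
          (c * ∏ j, ((r j + R j) / 2) ^ (2 * α j)) := by ring
      _ ≤ Real.pi ^ d * (C * ∏ j, R j ^ α j) * moment χ α := by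
          have := hm α
          have := (mul_pos hc (hqp α)).le
          gcongr
      _ = _ := by ring
  refine ⟨fun z => ∑' α, b α * ∏ j, z j ^ α j,
    (analyticOnNhd_tsum_monomial hσ0 hbb).mono fun z hz j => (hz j).trans_lt (hrσ j), ?_⟩
  funext z
  refine (hsum z).unique ((hasSum_projA_powerSeries hχ
    (summable_norm_monomial hσ0 hbb (fun j => (hr0 j).le) hrσ) z).congr_fun fun α => ?_)
  have h1 : (moment χ α : ℂ) ≠ 0 := by exact_mod_cast (hmpos α).ne'
  have h2 : (∏ j, (Nat.factorial (α j) : ℂ)) ≠ 0 := by exact_mod_cast (hfac α).ne'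
  have h3 : (Real.pi : ℂ) ^ d ≠ 0 := pow_ne_zero _ (by exact_mod_cast Real.pi_ne_zero)
  rw [hb, Finset.prod_div_distrib]
  field_simp


/-! ### Images of Gevrey distributions -/

/-- The remainder of order `N` of the exponential series. -/
noncomputable def expTail (N : ℕ) (t : ℂ) : ℂ :=
  Complex.exp t - ∑ n ∈ Finset.range N, t ^ n / (Nat.factorial n : ℂ)

/-- Truncated subtraction also covers `N = 0`, where the tail is the exponential itself. -/
theorem hasDerivAt_expTail (N : ℕ) (t : ℂ) : HasDerivAt (expTail N) (expTail (N - 1) t) t := by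
  refine (Complex.hasDerivAt_exp t).sub ?_
  cases N with
  | zero => simpa using hasDerivAt_const t (0 : ℂ)
  | succ N =>
    simp only [Nat.add_sub_cancel, Finset.sum_range_succ', pow_zero, Nat.factorial_zero,
      Nat.cast_one, div_one]
    refine HasDerivAt.add_const _ (HasDerivAt.fun_sum fun n _ => ?_)
    convert! (hasDerivAt_pow (n + 1) t).div_const (Nat.factorial (n + 1) : ℂ) using 1
    have h1 : (Nat.factorial n : ℂ) ≠ 0 := by exact_mod_cast n.factorial_ne_zero
    have h2 : (n : ℂ) + 1 ≠ 0 := by exact_mod_cast n.succ_ne_zero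
    rw [Nat.factorial_succ]
    push_cast
    field_simp

theorem contDiff_expTail (N : ℕ) : ContDiff ℝ ∞ (expTail N) := by
  unfold expTail
  refine (Complex.contDiff_exp).sub (ContDiff.sum fun n _ => ?_)
  fun_prop

/-- For `n ≥ N`, `|t|^n ≤ 2^{-N} (2|t|)^n`. -/
theorem norm_expTail_le (N : ℕ) (t : ℂ) :
    ‖expTail N t‖ ≤ (1 / 2) ^ N * Real.exp (2 * ‖t‖) := by
  refine (Complex.norm_exp_sub_sum_le_exp_norm_sub_sum t N).trans ?_
  have hs : ∀ x : ℝ, HasSum (fun n : ℕ => x ^ n / (Nat.factorial n : ℝ)) (Real.exp x) := fun x => by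
    rw [Real.exp_eq_exp_ℝ]; exact NormedSpace.expSeries_div_hasSum_exp x
  have h1 := (hs ‖t‖).summable.sum_add_tsum_nat_add N
  have h2 := (hs (2 * ‖t‖)).summable.sum_add_tsum_nat_add N
  rw [(hs _).tsum_eq] at h1 h2
  have h3 : ∑' n : ℕ, ‖t‖ ^ (n + N) / (Nat.factorial (n + N) : ℝ) ≤
      ∑' n : ℕ, (1 / 2 : ℝ) ^ N * ((2 * ‖t‖) ^ (n + N) / (Nat.factorial (n + N) : ℝ)) := by
    refine Summable.tsum_le_tsum (fun n => ?_) ((summable_nat_add_iff N).2 (hs _).summable)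
      (((summable_nat_add_iff N).2 (hs (2 * ‖t‖)).summable).mul_left _)
    rw [mul_div_assoc']
    gcongr
    have : (1 / 2 : ℝ) ^ N * (2 * ‖t‖) ^ (n + N) = 2 ^ n * ‖t‖ ^ (n + N) := by
      rw [mul_pow, pow_add (2 : ℝ) n N, div_pow, one_pow]
      field_simp
    rw [this]
    exact le_mul_of_one_le_left (by positivity) (one_le_pow₀ one_le_two)
  rw [tsum_mul_left] at h3
  have h4 : 0 ≤ ∑ n ∈ Finset.range N, (2 * ‖t‖) ^ n / (Nat.factorial n : ℝ) :=
    Finset.sum_nonneg fun n _ => by positivity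
  have h5 : ∑' n : ℕ, (2 * ‖t‖) ^ (n + N) / (Nat.factorial (n + N) : ℝ) ≤ Real.exp (2 * ‖t‖) := by
    linarith
  have := mul_le_mul_of_nonneg_left h5 (show (0 : ℝ) ≤ (1 / 2) ^ N by positivity)
  linarith

/-! ### Factorial bounds for iterated derivatives -/

section

variable {E : Type*} [NormedAddCommGroup E] [NormedSpace ℝ E]

theorem norm_iteratedFDeriv_expTail_comp_le (L : E →L[ℝ] ℂ) (k : ℕ) : ∀ (N : ℕ) (x : E),
    ‖iteratedFDeriv ℝ k (fun x => expTail N (L x)) x‖ ≤ ‖L‖ ^ k * ‖expTail (N - k) (L x)‖ := by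
  induction k with
  | zero => intro N x; simp
  | succ k ih =>
    intro N x
    -- The derivative of `expTail N ∘ L` is the lower tail times the constant functional `L`, so
    -- each differentiation costs one factor `‖L‖` and one order.
    let T : ℂ →L[ℝ] (E →L[ℝ] ℂ) := LinearMap.mkContinuous
      { toFun := fun c => c • L
        map_add' := fun a b => add_smul a b L
        map_smul' := fun a b => smul_assoc a b L } ‖L‖
      fun c => by
        simp only [LinearMap.coe_mk, AddHom.coe_mk]
        rw [norm_smul, mul_comm]
    have hT : ‖T‖ ≤ ‖L‖ := LinearMap.mkContinuous_norm_le _ (norm_nonneg _) _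
    have hf : fderiv ℝ (fun x => expTail N (L x)) = T ∘ fun x => expTail (N - 1) (L x) := by
      funext y
      have h := ((hasDerivAt_expTail N (L y)).hasFDerivAt.restrictScalars ℝ).comp y
        L.hasFDerivAt
      refine h.fderiv.trans ?_
      ext v
      simp [T, mul_comm]
    rw [← norm_iteratedFDeriv_fderiv, hf]
    have hc : ContDiff ℝ ∞ fun x => expTail (N - 1) (L x) :=
      (contDiff_expTail _).comp L.contDiff
    refine (T.norm_iteratedFDeriv_comp_left hc.contDiffAt
      (by exact_mod_cast le_top)).trans ?_
    refine (mul_le_mul hT (ih (N - 1) x) (norm_nonneg _) (norm_nonneg _)).trans_eq ?_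
    rw [Nat.sub_sub, Nat.add_comm 1 k]
    ring

/-- The decay `2^{-k}` lost by differentiating is regained from `A^k ≤ 2^{-k} exp (2A) k!`, so
`2^{-N}` holds uniformly in `k`. -/
theorem norm_iteratedFDeriv_expTail_comp_le_factorial {L : E →L[ℝ] ℂ} {A R : ℝ} (hA : ‖L‖ ≤ A)
    {x : E} (hx : ‖x‖ ≤ R) (N k : ℕ) :
    ‖iteratedFDeriv ℝ k (fun x => expTail N (L x)) x‖ ≤
      (1 / 2) ^ N * Real.exp (2 * A * (1 + R)) * (Nat.factorial k : ℝ) := by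
  have hA0 : 0 ≤ A := (norm_nonneg _).trans hA
  have hf : (0 : ℝ) < Nat.factorial k := by positivity
  have h1 : A ^ k ≤ (1 / 2) ^ k * Real.exp (2 * A) * (Nat.factorial k : ℝ) := by
    have := Real.pow_div_factorial_le_exp (2 * A) (by positivity) k
    rw [div_le_iff₀ hf, mul_pow] at this
    have h2 : A ^ k = (1 / 2) ^ k * (2 ^ k * A ^ k) := by
      rw [div_pow, one_pow]; field_simp
    rw [h2, mul_assoc]
    gcongr
  have h2 : ‖L x‖ ≤ A * R := (L.le_opNorm x).trans (mul_le_mul hA hx (norm_nonneg _) hA0)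
  have h3 : ((1 / 2 : ℝ)) ^ k * (1 / 2) ^ (N - k) ≤ (1 / 2) ^ N := by
    rw [← pow_add]
    exact pow_le_pow_of_le_one (by norm_num) (by norm_num) (by omega)
  calc _ ≤ ‖L‖ ^ k * ‖expTail (N - k) (L x)‖ := norm_iteratedFDeriv_expTail_comp_le L k N x
    _ ≤ A ^ k * ((1 / 2) ^ (N - k) * Real.exp (2 * (A * R))) := by
      refine mul_le_mul (pow_le_pow_left₀ (norm_nonneg _) hA k)
        ((norm_expTail_le _ _).trans ?_) (norm_nonneg _) (by positivity)
      gcongr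
    _ ≤ ((1 / 2) ^ k * Real.exp (2 * A) * (Nat.factorial k : ℝ)) *
        ((1 / 2) ^ (N - k) * Real.exp (2 * (A * R))) := by gcongr
    _ = ((1 / 2) ^ k * (1 / 2) ^ (N - k)) * (Real.exp (2 * A) * Real.exp (2 * (A * R))) *
        (Nat.factorial k : ℝ) := by ring
    _ ≤ (1 / 2) ^ N * (Real.exp (2 * A) * Real.exp (2 * (A * R))) * (Nat.factorial k : ℝ) := by
      gcongr
    _ = _ := by
      rw [← Real.exp_add]
      congr 3
      ring

/-- In the Leibniz formula `choose k i * i! * (k - i)! = k!`; the `k + 1 ≤ 2^k` terms turn `h` into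
`2 * h`. -/
theorem norm_iteratedFDeriv_mul_le_factorial {f g : E → ℂ} (hf : ContDiff ℝ ∞ f)
    (hg : ContDiff ℝ ∞ g) {x : E} {P C h : ℝ} (hh : 1 ≤ h)
    (hfb : ∀ k, ‖iteratedFDeriv ℝ k f x‖ ≤ P * (Nat.factorial k : ℝ))
    (hgb : ∀ k, ‖iteratedFDeriv ℝ k g x‖ ≤ C * h ^ k * (Nat.factorial k : ℝ)) (k : ℕ) :
    ‖iteratedFDeriv ℝ k (fun y => f y * g y) x‖ ≤
      P * C * ((2 * h) ^ k * (Nat.factorial k : ℝ)) := by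
  have hP : 0 ≤ P := by simpa using (norm_nonneg _).trans (hfb 0)
  have hC : 0 ≤ C := by simpa using (norm_nonneg _).trans (hgb 0)
  refine (norm_iteratedFDeriv_mul_le hf hg x (n := k) (by exact_mod_cast le_top)).trans ?_
  calc _ ≤ ∑ i ∈ Finset.range (k + 1), P * C * (h ^ k * (Nat.factorial k : ℝ)) := by
        refine Finset.sum_le_sum fun i hi => ?_
        have hik : i ≤ k := Nat.lt_succ_iff.1 (Finset.mem_range.1 hi)
        have hch : (k.choose i : ℝ) * (Nat.factorial i : ℝ) * (Nat.factorial (k - i) : ℝ) =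
            (Nat.factorial k : ℝ) := by exact_mod_cast Nat.choose_mul_factorial_mul_factorial hik
        calc _ ≤ (k.choose i : ℝ) * (P * (Nat.factorial i : ℝ)) *
              (C * h ^ (k - i) * (Nat.factorial (k - i) : ℝ)) := by
              gcongr
              · exact hfb i
              · exact hgb (k - i)
          _ = P * C * (h ^ (k - i) * (Nat.factorial k : ℝ)) := by rw [← hch]; ring
          _ ≤ _ := by
              gcongr
              exact Nat.sub_le _ _
    _ = P * C * (((k : ℝ) + 1) * h ^ k * (Nat.factorial k : ℝ)) := by
        rw [Finset.sum_const, Finset.card_range, nsmul_eq_mul]; push_cast; ring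
    _ ≤ P * C * (2 ^ k * h ^ k * (Nat.factorial k : ℝ)) := by
        have : (k : ℝ) + 1 ≤ 2 ^ k := by exact_mod_cast Nat.lt_two_pow_self
        gcongr
    _ = _ := by rw [mul_pow]

/-- Derivatives of `L` of order at least two vanish, so only two Leibniz terms remain. The factor
`k` is absorbed by `k!`, and `h` does not grow, which permits iteration over arbitrarily many
factors. -/
theorem norm_iteratedFDeriv_clm_mul_le {L : E →L[ℝ] ℂ} (hL : ‖L‖ ≤ 1) {g : E → ℂ}
    (hg : ContDiff ℝ ∞ g) {x : E} {M h R : ℝ} (hh : 1 ≤ h) (hx : ‖x‖ ≤ R)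
    (hgb : ∀ k, ‖iteratedFDeriv ℝ k g x‖ ≤ M * (h ^ k * (Nat.factorial k : ℝ))) (k : ℕ) :
    ‖iteratedFDeriv ℝ k (fun y => L y * g y) x‖ ≤
      M * (R + 1) * (h ^ k * (Nat.factorial k : ℝ)) := by
  have hM : 0 ≤ M := by simpa using (norm_nonneg _).trans (hgb 0)
  have hR : 0 ≤ R := (norm_nonneg _).trans hx
  have hLx : ‖L x‖ ≤ R := by
    simpa using (L.le_opNorm x).trans (mul_le_mul hL hx (norm_nonneg _) zero_le_one)
  have hfd : fderiv ℝ L = fun _ => L := by funext y; exact L.fderiv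
  have h1 : ‖iteratedFDeriv ℝ 1 L x‖ ≤ 1 := by
    rw [← zero_add 1, ← norm_iteratedFDeriv_fderiv, hfd, norm_iteratedFDeriv_zero]
    exact hL
  have h2 : ∀ i, iteratedFDeriv ℝ (i + 2) L x = 0 := fun i => by
    rw [← norm_eq_zero, ← norm_iteratedFDeriv_fderiv, hfd, iteratedFDeriv_succ_const]
    simp
  refine (norm_iteratedFDeriv_mul_le L.contDiff hg x (n := k) (by exact_mod_cast le_top)).trans ?_
  cases k with
  | zero =>
    have := hgb 0
    simp only [zero_add, Nat.sub_zero, Finset.range_one, Finset.sum_singleton, Nat.choose_self, Nat.cast_one,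
      one_mul, norm_iteratedFDeriv_zero, pow_zero, Nat.factorial_zero, mul_one] at this ⊢
    rw [mul_comm M]
    exact mul_le_mul (by linarith) this (norm_nonneg _) (by positivity)
  | succ k =>
    rw [Finset.sum_range_succ', Finset.sum_range_succ',
      Finset.sum_eq_zero fun i _ => by rw [h2]; simp]
    simp only [zero_add, Nat.choose_one_right, Nat.choose_zero_right, Nat.cast_one, one_mul,
      norm_iteratedFDeriv_zero, Nat.sub_zero]
    have e : ((k + 1 : ℕ) : ℝ) * (Nat.factorial k : ℝ) = (Nat.factorial (k + 1) : ℝ) := by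
      exact_mod_cast (Nat.factorial_succ k).symm
    have b1 : ((k + 1 : ℕ) : ℝ) * ‖iteratedFDeriv ℝ 1 L x‖ * ‖iteratedFDeriv ℝ k g x‖ ≤
        M * (h ^ (k + 1) * (Nat.factorial (k + 1) : ℝ)) := by
      calc _ ≤ ((k + 1 : ℕ) : ℝ) * 1 * (M * (h ^ k * (Nat.factorial k : ℝ))) := by
            gcongr
            exact hgb k
        _ = M * (h ^ k * (Nat.factorial (k + 1) : ℝ)) := by rw [← e]; ring
        _ ≤ _ := by
            gcongr
            exact Nat.le_succ k
    have b2 : ‖L x‖ * ‖iteratedFDeriv ℝ (k + 1) g x‖ ≤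
        R * (M * (h ^ (k + 1) * (Nat.factorial (k + 1) : ℝ))) :=
      mul_le_mul hLx (hgb (k + 1)) (norm_nonneg _) hR
    exact (add_le_add b1 b2).trans_eq (by ring)

theorem norm_iteratedFDeriv_prod_clm_mul_le {g : E → ℂ} (hg : ContDiff ℝ ∞ g) {x : E}
    {M h R : ℝ} (hh : 1 ≤ h) (hx : ‖x‖ ≤ R)
    (hgb : ∀ k, ‖iteratedFDeriv ℝ k g x‖ ≤ M * (h ^ k * (Nat.factorial k : ℝ))) :
    ∀ {n : ℕ} (L : Fin n → (E →L[ℝ] ℂ)), (∀ i, ‖L i‖ ≤ 1) → ∀ k,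
      ‖iteratedFDeriv ℝ k (fun y => (∏ i, L i y) * g y) x‖ ≤
        M * (R + 1) ^ n * (h ^ k * (Nat.factorial k : ℝ))
  | 0, L, _, k => by simpa using hgb k
  | n + 1, L, hL, k => by
    have ih := norm_iteratedFDeriv_prod_clm_mul_le hg hh hx hgb (fun i => L i.succ)
      fun i => hL i.succ
    have hc : ContDiff ℝ ∞ fun y => (∏ i : Fin n, L i.succ y) * g y :=
      (contDiff_prod fun i _ => (L i.succ).contDiff).mul hg
    have h1 := norm_iteratedFDeriv_clm_mul_le (hL 0) hc hh hx ih k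
    simp only [Fin.prod_univ_succ, mul_assoc] at h1 ⊢
    refine h1.trans_eq ?_
    ring

end

/-! ### Termwise action of a Gevrey distribution on the kernel -/

/-- The real-linear functional `w ↦ conj w_j`. -/
noncomputable def conjCoord {d : ℕ} (j : Fin d) : (Fin d → ℂ) →L[ℝ] ℂ :=
  (Complex.conjCLE : ℂ →L[ℝ] ℂ).comp
    (ContinuousLinearMap.proj (R := ℝ) (φ := fun _ : Fin d => ℂ) j)

@[simp] theorem conjCoord_apply {d : ℕ} (j : Fin d) (w : Fin d → ℂ) :
    conjCoord j w = conj (w j) := rfl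

theorem norm_conjCoord_le {d : ℕ} (j : Fin d) : ‖conjCoord j‖ ≤ 1 := by
  refine ContinuousLinearMap.opNorm_le_bound _ zero_le_one fun w => ?_
  rw [conjCoord_apply, RCLike.norm_conj, one_mul]
  exact norm_le_pi_norm w j

/-- The function `w ↦ conj w ^ α * exp (-|w|²)`. -/
noncomputable def conjMonomialGauss {d : ℕ} (α : Fin d → ℕ) (w : Fin d → ℂ) : ℂ :=
  (∏ j, conj (w j) ^ α j) * bargmannKernel 0 w

theorem conjMonomialGauss_mem {d : ℕ} {s : ℝ} (hs : 1 < s) (α : Fin d → ℕ) :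
    conjMonomialGauss α ∈ gevreySpace d s := by
  refine isGevrey_of_analytic hs.le fun w _ => ?_
  refine AnalyticAt.mul ?_ (analytic_bargmannKernel 0 w (mem_univ w))
  exact Finset.analyticAt_fun_prod _ fun j _ => ((conjCoord j).analyticAt w).pow (α j)

theorem pow_div_factorial_eq_sum {d : ℕ} (x : Fin d → ℂ) (n : ℕ) :
    (∑ j, x j) ^ n / (Nat.factorial n : ℂ) =
      ∑ α ∈ Finset.univ.piAntidiag n, ∏ j, x j ^ α j / (Nat.factorial (α j) : ℂ) := by
  rw [Finset.sum_pow_eq_sum_piAntidiag, Finset.sum_div]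
  refine Finset.sum_congr rfl fun α hα => ?_
  have hn : ∑ j, α j = n := (Finset.mem_piAntidiag.1 hα).1
  have h := Nat.multinomial_spec Finset.univ α
  rw [hn] at h
  have h' : (∏ j, (Nat.factorial (α j) : ℂ)) * (Nat.multinomial Finset.univ α : ℂ) =
      (Nat.factorial n : ℂ) := by exact_mod_cast h
  have h1 : (Nat.factorial n : ℂ) ≠ 0 := by exact_mod_cast n.factorial_ne_zero
  have h2 : (∏ j, (Nat.factorial (α j) : ℂ)) ≠ 0 :=
    Finset.prod_ne_zero_iff.2 fun j _ => by exact_mod_cast (α j).factorial_ne_zero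
  rw [Finset.prod_div_distrib, div_eq_div_iff h1 h2, ← h']
  ring

theorem projADual_mem_spaceAFlatOne {d : ℕ} {s : ℝ} (hs : 1 < s)
    {u : gevreySpace d s →ₗ[ℂ] ℂ} (hu : u ∈ gevreyDual d s) :
    projADual hs u ∈ spaceAFlatOne d := by
  obtain ⟨K, hK, hu⟩ := hu
  obtain ⟨R, hR0, hR⟩ : ∃ R : ℝ, 0 ≤ R ∧ ∀ x ∈ K, ‖x‖ ≤ R := by
    obtain ⟨R, hR⟩ := hK.isBounded.exists_norm_le
    exact ⟨max R 0, le_max_right _ _, fun x hx => (hR x hx).trans (le_max_left _ _)⟩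
  obtain ⟨hgs, hgb⟩ := isGevrey_of_analytic (le_refl (1 : ℝ)) (analytic_bargmannKernel (d := d) 0)
  obtain ⟨C, h₀, hC, hh₀, hg⟩ := hgb K hK
  set h := max h₀ 1 with hh
  have hh1 : 1 ≤ h := le_max_right _ _
  have hg' : ∀ k : ℕ, ∀ x ∈ K, ‖iteratedFDeriv ℝ k (bargmannKernel (d := d) 0) x‖ ≤
      C * h ^ k * (Nat.factorial k : ℝ) := fun k x hx => by
    refine (hg k x hx).trans ?_
    rw [Real.rpow_one]
    gcongr
    exact le_max_left _ _
  have hgh : ∀ k : ℕ, ∀ x ∈ K, ‖iteratedFDeriv ℝ k (bargmannKernel (d := d) 0) x‖ ≤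
      C * ((2 * h) ^ k * (Nat.factorial k : ℝ)) := fun k x hx => by
    refine (hg' k x hx).trans ?_
    rw [mul_assoc]
    gcongr
    linarith
  -- A single value of `h` is used: twice that of the Gaussian, to allow for the Leibniz loss in the
  -- remainder.
  obtain ⟨D, hD⟩ := hu (2 * h) (by positivity)
  have hest : ∀ φ : gevreySpace d s, ∀ M : ℝ, 0 ≤ M →
      (∀ k : ℕ, ∀ x ∈ K, ‖iteratedFDeriv ℝ k (φ : (Fin d → ℂ) → ℂ) x‖ ≤
        M * ((2 * h) ^ k * (Nat.factorial k : ℝ))) → ‖u φ‖ ≤ D * M := fun φ M hM H => by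
    refine hD φ M hM fun k x hx => (H k x hx).trans ?_
    have h1 : (1 : ℝ) ≤ (Nat.factorial k : ℝ) := by exact_mod_cast k.factorial_pos
    have := Real.self_le_rpow_of_one_le h1 hs.le
    gcongr
  set ψ : (Fin d → ℕ) → gevreySpace d s := fun α =>
    ⟨conjMonomialGauss α, conjMonomialGauss_mem hs α⟩ with hψ
  have hψb : ∀ α, ‖u (ψ α)‖ ≤ D * C * ∏ j, (R + 1) ^ α j := by
    intro α
    obtain ⟨σ, hσ⟩ := exists_word α
    rw [mul_assoc, Finset.prod_pow_eq_pow_sum]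
    refine hest (ψ α) _ (by positivity) fun k x hx => ?_
    have h1 := norm_iteratedFDeriv_prod_clm_mul_le hgs (h := 2 * h) (by linarith) (hR x hx)
      (fun k => hgh k x hx) (fun i => conjCoord (σ i)) (fun i => norm_conjCoord_le _) k
    convert! h1 using 3
    funext y
    simp only [hψ, conjMonomialGauss, conjCoord_apply]
    rw [hσ fun j => conj (y j)]
  set L : (Fin d → ℂ) → ((Fin d → ℂ) →L[ℝ] ℂ) := fun z => ∑ j, z j • conjCoord j with hL
  have hLz : ∀ z w, L z w = ∑ j, z j * conj (w j) := fun z w => by simp [hL]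
  -- The difference is `u` applied to the exponential tail of `(z, w)` times the Gaussian, small by
  -- the factor `2^{-N}`.
  have hrem : ∀ z N, ‖u ⟨bargmannKernel z, bargmannKernel_mem hs z⟩ -
      ∑ n ∈ Finset.range N, ∑ α ∈ Finset.univ.piAntidiag n,
        (∏ j, z j ^ α j / (Nat.factorial (α j) : ℂ)) * u (ψ α)‖ ≤
      D * ((1 / 2) ^ N * Real.exp (2 * ‖L z‖ * (1 + R)) * C) := by
    intro z N
    have e : u ⟨bargmannKernel z, bargmannKernel_mem hs z⟩ -
        ∑ n ∈ Finset.range N, ∑ α ∈ Finset.univ.piAntidiag n,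
          (∏ j, z j ^ α j / (Nat.factorial (α j) : ℂ)) * u (ψ α) =
        u (⟨bargmannKernel z, bargmannKernel_mem hs z⟩ -
          ∑ n ∈ Finset.range N, ∑ α ∈ Finset.univ.piAntidiag n,
            (∏ j, z j ^ α j / (Nat.factorial (α j) : ℂ)) • ψ α) := by
      simp only [map_sub, map_sum, map_smul, smul_eq_mul]
    rw [e]
    refine hest _ _ (by positivity) fun k x hx => ?_
    have h1 := norm_iteratedFDeriv_mul_le_factorial
      ((contDiff_expTail N).comp (L z).contDiff) hgs hh1
      (norm_iteratedFDeriv_expTail_comp_le_factorial (L := L z) le_rfl (hR x hx) N)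
      (fun k => hg' k x hx) k
    convert! h1 using 3
    funext w
    simp only [Submodule.coe_sub, Submodule.coe_sum, Submodule.coe_smul, Pi.sub_apply,
      Finset.sum_apply, Pi.smul_apply, smul_eq_mul, Function.comp, expTail, hLz, sub_mul,
      Finset.sum_mul, pow_div_factorial_eq_sum, hψ, conjMonomialGauss]
    rw [bargmannKernel_eq_mul z w]
    congr 1
    refine Finset.sum_congr rfl fun n _ => Finset.sum_congr rfl fun α _ => ?_
    simp only [mul_pow, Finset.prod_div_distrib, Finset.prod_mul_distrib]
    ring
  have hsum : ∀ z, HasSum (fun α : Fin d → ℕ =>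
      (∏ j, z j ^ α j / (Nat.factorial (α j) : ℂ)) * u (ψ α))
      (u ⟨bargmannKernel z, bargmannKernel_mem hs z⟩) := by
    intro z
    -- The remainder only controls partial sums by degree; absolute summability, from the bound on
    -- `u (ψ α)`, gives the unordered sum.
    have hs1 : Summable fun α : Fin d → ℕ =>
        (∏ j, z j ^ α j / (Nat.factorial (α j) : ℂ)) * u (ψ α) := by
      refine Summable.of_norm_bounded
        ((hasSum_prod_real_exp fun j => ‖z j‖ * (R + 1)).summable.mul_left (D * C)) fun α => ?_
      rw [norm_mul, norm_prod]
      simp only [norm_div, norm_pow, Complex.norm_natCast, mul_pow]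
      refine (mul_le_mul_of_nonneg_left (hψb α) (by positivity)).trans_eq ?_
      simp only [Finset.prod_div_distrib, Finset.prod_mul_distrib]
      ring
    have ht := (hasSum_fiberwise_degree hs1.hasSum).tendsto_sum_nat
    have ht2 : Filter.Tendsto (fun N => ∑ n ∈ Finset.range N, ∑ α ∈ Finset.univ.piAntidiag n,
        (∏ j, z j ^ α j / (Nat.factorial (α j) : ℂ)) * u (ψ α)) Filter.atTop
        (nhds (u ⟨bargmannKernel z, bargmannKernel_mem hs z⟩)) := by
      rw [tendsto_iff_norm_sub_tendsto_zero]
      refine squeeze_zero (fun _ => norm_nonneg _)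
        (fun N => (norm_sub_rev _ _).trans_le (hrem z N)) ?_
      have h0 := tendsto_pow_atTop_nhds_zero_of_lt_one (show (0 : ℝ) ≤ 1 / 2 by norm_num)
        (by norm_num)
      simpa using ((h0.mul_const (Real.exp (2 * ‖L z‖ * (1 + R)))).mul_const C).const_mul D
    rw [tendsto_nhds_unique ht2 ht]
    exact hs1.hasSum
  refine mem_spaceAFlatOne_iff.2 ⟨fun α => ((Real.pi : ℂ) ^ d)⁻¹ *
    (u (ψ α) / ∏ j, (Nat.factorial (α j) : ℂ)), ⟨fun _ => R + 1, fun _ => by positivity,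
      ‖((Real.pi : ℂ) ^ d)⁻¹‖ * (D * C), fun α => ?_⟩, fun z => ?_⟩
  · rw [norm_mul, norm_div, norm_prod, mul_assoc]
    simp only [Complex.norm_natCast]
    rw [Finset.prod_div_distrib, ← mul_div_assoc (D * C)]
    exact mul_le_mul_of_nonneg_left (div_le_div_of_nonneg_right (hψb α) (by positivity))
      (norm_nonneg _)
  · refine ((hsum z).mul_left ((Real.pi : ℂ) ^ d)⁻¹).congr_fun fun α => ?_
    rw [Finset.prod_div_distrib]
    ring

end BargmannPW

/-! ### The equivalences and the images of `Π_A` -/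

theorem mainTheorem1 (d : ℕ) (s : ℝ) (hs : 1 < s) :
    (∀ F : (Fin d → ℂ) → ℂ, AnalyticOnNhd ℂ F Set.univ →
      List.TFAE [
        F ∈ BargmannPW.spaceAFlatOne d,
        ∃ r : Fin d → ℝ, (∀ j, 0 < r j) ∧
          ∃ C : ℝ, ∀ z, ‖F z‖ ≤ C * Real.exp (∑ j, r j * ‖z j‖),
        ∃ ρ : Fin d → ℝ, (∀ j, 0 < ρ j) ∧ ∀ r : Fin d → ℝ, (∀ j, ρ j ≤ r j) →
          ∃ r₀ : Fin d → ℝ, (∀ j, 0 < r₀ j ∧ r₀ j < r j) ∧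
            ∀ χ : (Fin d → ℂ) → ℝ, BargmannPW.IsRadialCutoff r₀ r χ →
              ∃ F₀ : (Fin d → ℂ) → ℂ, AnalyticOnNhd ℂ F₀ (BargmannPW.closedPolydisc r) ∧
                F = BargmannPW.projA (fun w => F₀ w * (χ w : ℂ)),
        ∃ r₀ : Fin d → ℝ, (∀ j, 0 < r₀ j) ∧ ∀ r : Fin d → ℝ, (∀ j, r₀ j < r j) →
          ∃ χ : (Fin d → ℂ) → ℝ, BargmannPW.IsRadialCutoff r₀ r χ ∧
            ∃ F₀ : (Fin d → ℂ) → ℂ, AnalyticOnNhd ℂ F₀ (BargmannPW.closedPolydisc r) ∧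
              F = BargmannPW.projA (fun w => F₀ w * (χ w : ℂ)),
        ∃ F₀ ∈ BargmannPW.boundedCompact d, F = BargmannPW.projA F₀,
        ∃ u ∈ BargmannPW.gevreyDual d s, F = BargmannPW.projADual hs u]) ∧
    BargmannPW.projADual hs '' BargmannPW.gevreyDual d s = BargmannPW.spaceAFlatOne d ∧
    BargmannPW.projA '' BargmannPW.analyticCompact d = BargmannPW.spaceAFlatOne d := by
  -- The indicator of the closed polydisc is a cutoff for every inner radius at most `r`. It thus
  -- fits both the `r`-dependent `r₀` of condition 3 and the fixed one of condition 4, and the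
  -- resulting product lies in `L^∞_{A,c}`.
  have h34 : ∀ F : (Fin d → ℂ) → ℂ,
      (∃ ρ : Fin d → ℝ, (∀ j, 0 < ρ j) ∧ ∀ r : Fin d → ℝ, (∀ j, ρ j ≤ r j) →
        ∃ r₀ : Fin d → ℝ, (∀ j, 0 < r₀ j ∧ r₀ j < r j) ∧
          ∀ χ : (Fin d → ℂ) → ℝ, BargmannPW.IsRadialCutoff r₀ r χ →
            ∃ F₀ : (Fin d → ℂ) → ℂ, AnalyticOnNhd ℂ F₀ (BargmannPW.closedPolydisc r) ∧
              F = BargmannPW.projA (fun w => F₀ w * (χ w : ℂ))) →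
      ∃ ρ : Fin d → ℝ, (∀ j, 0 < ρ j) ∧ ∀ r : Fin d → ℝ, (∀ j, ρ j < r j) →
        ∃ F₀ : (Fin d → ℂ) → ℂ, AnalyticOnNhd ℂ F₀ (BargmannPW.closedPolydisc r) ∧
          F = BargmannPW.projA (fun w => F₀ w *
            (((BargmannPW.closedPolydisc r).indicator (fun _ => 1) w : ℝ) : ℂ)) := by
    rintro F ⟨ρ, hρ, H⟩
    refine ⟨ρ, hρ, fun r hr => ?_⟩
    obtain ⟨r₀, hr₀, H'⟩ := H r fun j => (hr j).le
    exact H' _ (BargmannPW.isRadialCutoff_indicator fun j => (hr₀ j).2.le)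
  have hA : ∀ F ∈ BargmannPW.spaceAFlatOne d, ∃ G ∈ BargmannPW.analyticCompact d,
      BargmannPW.projA G = F := by
    intro F hF
    obtain ⟨ρ, hρ, H⟩ := h34 F (BargmannPW.exists_analytic_preimage hF)
    obtain ⟨F₀, hF₀, rfl⟩ := H (fun j => ρ j + 1) fun j => lt_add_one _
    refine ⟨_, ⟨_, BargmannPW.isCompact_closedPolydisc _, F₀, hF₀, rfl⟩, ?_⟩
    congr 1
    funext w
    by_cases hw : w ∈ BargmannPW.closedPolydisc fun j => ρ j + 1 <;> simp [hw]
  refine ⟨fun F hF => ?_, ?_, ?_⟩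
  · tfae_have 1 → 2 := BargmannPW.exp_bound_of_mem_spaceAFlatOne
    tfae_have 2 → 1 := fun ⟨_, hr, _, hC⟩ => BargmannPW.mem_spaceAFlatOne_of_exp_bound hF hr hC
    tfae_have 1 → 3 := BargmannPW.exists_analytic_preimage
    tfae_have 3 → 4 := by
      intro h
      obtain ⟨ρ, hρ, H⟩ := h34 F h
      exact ⟨ρ, hρ, fun r hr =>
        ⟨_, BargmannPW.isRadialCutoff_indicator fun j => (hr j).le, H r hr⟩⟩
    tfae_have 4 → 5 := by
      rintro ⟨r₀, hr₀, H⟩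
      obtain ⟨χ, hχ, F₀, hF₀, h⟩ := H (fun j => r₀ j + 1) fun j => lt_add_one _
      exact ⟨_, BargmannPW.mul_cutoff_mem_boundedCompact hχ hF₀.continuousOn, h⟩
    tfae_have 5 → 6 := by
      rintro ⟨F₀, hF₀, rfl⟩
      exact BargmannPW.exists_gevreyDual_of_mem_boundedCompact hs hF₀
    tfae_have 6 → 1 := by
      rintro ⟨u, hu, rfl⟩
      exact BargmannPW.projADual_mem_spaceAFlatOne hs hu
    tfae_finish
  · refine Set.Subset.antisymm ?_ fun F hF => ?_
    · rintro _ ⟨u, hu, rfl⟩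
      exact BargmannPW.projADual_mem_spaceAFlatOne hs hu
    · obtain ⟨G, hG, rfl⟩ := hA F hF
      obtain ⟨u, hu, h⟩ := BargmannPW.exists_gevreyDual_of_mem_boundedCompact hs
        (BargmannPW.analyticCompact_subset_boundedCompact d hG)
      exact ⟨u, hu, h.symm⟩
  · refine Set.Subset.antisymm ?_ hA
    rintro _ ⟨G, hG, rfl⟩
    obtain ⟨u, hu, h⟩ := BargmannPW.exists_gevreyDual_of_mem_boundedCompact hs
      (BargmannPW.analyticCompact_subset_boundedCompact d hG)
    rw [h]
    exact BargmannPW.projADual_mem_spaceAFlatOne hs hu
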